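/- Let $p$ be a prime with $p\equiv 1$ or $9\pmod{40}$. Then there are integers $c,d,x,y$ with $p=c^2+d^2=x^2+10y^2$. Moreover, let $c,d,x,y\in\mathbb Z$ be any integers with $p=c^2+d^2=x^2+10y^2$ and $c\equiv 1\pmod 4$, and suppose that $d=2^rd_0$ with $r\ge 0$ and $d_0$ integers and $d_0\equiv 1\pmod 4$. Assume that $\gcd(c,x+d)=1$ or $\gcd(d_0,x+c)=1$. Then $4\mid d$, $2\mid x-1$, $2\mid y$, $p\nmid d$, $5\nmid x$, and $$(-5)^{\frac{p-1}8}\equiv\begin{cases}\pm(-1)^{\frac d4+\frac{x-1}2+\frac y2}\pmod p&\text{if }\frac{2c-d}x\equiv\pm2\pmod 5,\\[2pt] \pm(-1)^{\frac d4+\frac{x-1}2+\frac y2}\,\frac cd\pmod p&\text{if }\frac{2c-d}x\equiv\pm1\pmod 5,\end{cases}$$ where in each line the same sign is taken on both sides, and the fractions $\frac cd$ and $\frac{2c-d}x$ are residue classes modulo $p$ and modulo $5$ respectively. -/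

import Mathlib

/-- Five is prime; this makes `ZMod 5` a field, so that `(2c - d)/x mod 5` is a genuine quotient. -/
instance fact_prime_five : Fact (Nat.Prime 5) := ⟨by norm_num⟩

/-!
Let `π = c + di`, a Gaussian prime of norm `p`. Raising `-2qy² ≡ x²` to the power `(p - 1) / 8`
shows that `(-q) ^ ((p - 1) / 8)` is determined by `2 ^ ((p - 1) / 8)` and by the quartic
residue symbols of `x` and `y` modulo `π`. By quartic reciprocity these are quartic Jacobi symbols
of `π` modulo `x` and modulo the odd part `y₀` of `y`.
The symbol modulo `x` only sees `c + (x + d)i = g(1 + i)W`, and the relation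
`g N(W) = x(Re W + Im W) + qy² / g`, read modulo `W`, expresses it through the symbols modulo
`q` and modulo `y₀² / g`. Comparing the latter with the symbol of `π` modulo `y₀` prime by prime
eliminates `y₀`, and what remains is the quartic Jacobi symbol of `c + (x + d)i` modulo `q`, which
for `q = 5` is a finite computation.
-/

/-! ### Discrete logarithms of roots of unity -/

section RootLog

/-- The discrete logarithm in `ZMod n` of an `n`-th root of unity `y`, to the base of a primitive
`n`-th root of unity `ζ`. The value is junk when `y` is not a power of `ζ`. -/
noncomputable def rootLog {M : Type*} [Monoid M] (n : ℕ) (ζ y : M) : ZMod n :=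
  Function.invFun (fun j : ZMod n => ζ ^ j.val) y

theorem pow_val_add {M : Type*} [Monoid M] {n : ℕ} [NeZero n] {ζ : M} (hζ : ζ ^ n = 1)
    (j k : ZMod n) : ζ ^ (j + k).val = ζ ^ j.val * ζ ^ k.val := by
  rw [ZMod.val_add, ← pow_add, ← pow_eq_pow_mod _ hζ]

theorem pow_val_natCast {M : Type*} [Monoid M] {n : ℕ} {ζ : M} (hζ : ζ ^ n = 1) (m : ℕ) :
    ζ ^ (m : ZMod n).val = ζ ^ m := by
  rw [ZMod.val_natCast, ← pow_eq_pow_mod _ hζ]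

theorem pow_val_intCast {G : Type*} [GroupWithZero G] {n : ℕ} [NeZero n] {ζ : G} (h0 : ζ ≠ 0)
    (hζ : ζ ^ n = 1) (m : ℤ) : ζ ^ (m : ZMod n).val = ζ ^ m := by
  rw [← zpow_natCast, ZMod.val_intCast]
  conv_rhs => rw [← Int.emod_add_mul_ediv m n, zpow_add₀ h0, zpow_mul, zpow_natCast ζ n, hζ,
    one_zpow, mul_one]

section CommMonoid

variable {M : Type*} [CommMonoid M] {n : ℕ} [NeZero n] {ζ : M}

theorem rootLog_pow_val (hζ : IsPrimitiveRoot ζ n) (j : ZMod n) : rootLog n ζ (ζ ^ j.val) = j :=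
  Function.leftInverse_invFun (f := fun j : ZMod n => ζ ^ j.val)
    (fun i j h => ZMod.val_injective n (hζ.pow_inj i.val_lt j.val_lt h)) j

theorem rootLog_eq (hζ : IsPrimitiveRoot ζ n) {y : M} {j : ZMod n} (h : ζ ^ j.val = y) :
    rootLog n ζ y = j := by
  rw [← h, rootLog_pow_val hζ]

theorem rootLog_one (hζ : IsPrimitiveRoot ζ n) : rootLog n ζ 1 = 0 :=
  rootLog_eq hζ (by rw [ZMod.val_zero, pow_zero])

end CommMonoid

theorem rootLog_zpow {K : Type*} [Field K] {n : ℕ} [NeZero n] {ζ : K}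
    (hζ : IsPrimitiveRoot ζ n) (m : ℤ) : rootLog n ζ (ζ ^ m) = m :=
  rootLog_eq hζ (pow_val_intCast (hζ.ne_zero (NeZero.ne n)) hζ.pow_eq_one m)

section Domain

variable {R : Type*} [CommRing R] [IsDomain R] {n : ℕ} [NeZero n] {ζ : R}

theorem pow_rootLog (hζ : IsPrimitiveRoot ζ n) {y : R} (hy : y ^ n = 1) :
    ζ ^ (rootLog n ζ y).val = y := by
  obtain ⟨i, -, rfl⟩ := hζ.eq_pow_of_pow_eq_one hy
  rw [rootLog_eq hζ (pow_val_natCast hζ.pow_eq_one i), pow_val_natCast hζ.pow_eq_one]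

theorem rootLog_mul (hζ : IsPrimitiveRoot ζ n) {y z : R} (hy : y ^ n = 1) (hz : z ^ n = 1) :
    rootLog n ζ (y * z) = rootLog n ζ y + rootLog n ζ z :=
  rootLog_eq hζ (by rw [pow_val_add hζ.pow_eq_one, pow_rootLog hζ hy, pow_rootLog hζ hz])

end Domain

theorem isPrimitiveRoot_four_of_sq_eq_neg_one {R : Type*} [CommRing R] {ζ : R}
    (hζ : ζ ^ 2 = -1) (h2 : (2 : R) ≠ 0) : IsPrimitiveRoot ζ 4 := by
  have h1 : ¬ ζ ^ 2 ^ 1 = 1 := by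
    rw [pow_one, hζ]
    exact fun h => h2 (by linear_combination -h)
  have h4 : ζ ^ 2 ^ 2 = 1 := by linear_combination (ζ ^ 2 - 1) * hζ
  exact IsPrimitiveRoot.iff_orderOf.mpr (orderOf_eq_prime_pow h1 h4)

end RootLog

section GaussianEval

variable {R : Type*} [CommRing R] {ζ : R}

/-- The ring homomorphism from the Gaussian integers sending `i` to a square root `ζ` of `-1`. -/
def gaussianEval (hζ : ζ ^ 2 = -1) : GaussianInt →+* R :=
  Zsqrtd.lift ⟨ζ, by rw [← sq, hζ, Int.cast_neg, Int.cast_one]⟩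

theorem gaussianEval_mul_star (hζ : ζ ^ 2 = -1) (α : GaussianInt) :
    gaussianEval hζ α * gaussianEval hζ (star α) = (α.norm : ℤ) := by
  rw [← map_mul, ← Zsqrtd.norm_eq_mul_conj, map_intCast]

end GaussianEval

theorem norm_eq_sq_add_sq (α : GaussianInt) : α.norm = α.re ^ 2 + α.im ^ 2 := by
  rw [Zsqrtd.norm_def]; ring

theorem eq_one_or_eq_neg_one_of_norm_eq_one {W : GaussianInt} (him : Even W.im)
    (hW : W.norm = 1) : W = 1 ∨ W = -1 := by
  obtain ⟨k, hk⟩ := him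
  rw [norm_eq_sq_add_sq] at hW
  have him0 : W.im = 0 := by
    have : k = 0 := by nlinarith [sq_nonneg W.re]
    omega
  rw [him0, zero_pow two_ne_zero, add_zero, sq_eq_one_iff] at hW
  exact hW.imp (fun hre => Zsqrtd.ext hre him0) fun hre => Zsqrtd.ext hre him0

theorem isCoprime_of_sq_add_mul_sq_eq_prime {p : ℕ} (hp : p.Prime) {x y n : ℤ}
    (h : (p : ℤ) = x ^ 2 + n * y ^ 2) : IsCoprime x y := by
  have hdvd : gcd x y * gcd x y ∣ (p : ℤ) := by
    rw [h, ← sq]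
    exact dvd_add (pow_dvd_pow_of_dvd (gcd_dvd_left x y) 2)
      ((pow_dvd_pow_of_dvd (gcd_dvd_right x y) 2).mul_left n)
  exact (gcd_isUnit_iff x y).mp ((Nat.prime_iff_prime_int.mp hp).irreducible.squarefree _ hdvd)

theorem intCast_ne_zero_of_isCoprime {R : Type*} [CommRing R] [Nontrivial R] (p : ℕ) [CharP R p]
    {m n : ℤ} (h : IsCoprime m n) (hpn : (p : ℤ) ∣ n) : (m : R) ≠ 0 := by
  have hcop := (h.of_isCoprime_of_dvd_right hpn).map (Int.castRingHom R)
  rw [eq_intCast, eq_intCast, Int.cast_natCast, CharP.cast_eq_zero, isCoprime_zero_right] at hcop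
  exact hcop.ne_zero

/-! ### The quartic residue character modulo a split prime -/

/-- `π` is a Gaussian prime of norm the rational prime `p`, normalised so that its imaginary part
is even. -/
structure IsSplitPrime (p : ℕ) (π : GaussianInt) : Prop where
  norm_eq : π.norm = p
  even_im : Even π.im

/-- The residue class of `i` modulo `π` in `ℤ[i] / π = ZMod p`, for `π` as in `IsSplitPrime p π`. -/
noncomputable def imagResidue (p : ℕ) [Fact p.Prime] (π : GaussianInt) : ZMod p :=
  -(π.re : ZMod p) / π.im

/-- The exponent, to the base `imagResidue p π`, of the quartic residue character
`n ^ ((p - 1) / 4)` modulo the split prime `π`. -/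
noncomputable def quarticChar (p : ℕ) [Fact p.Prime] (π : GaussianInt) (n : ZMod p) : ZMod 4 :=
  rootLog 4 (imagResidue p π) (n ^ ((p - 1) / 4))

namespace IsSplitPrime

variable {p : ℕ} [Fact p.Prime] {π : GaussianInt}

theorem sq_add_sq {p : ℕ} (h : IsSplitPrime p π) : (p : ℤ) = π.re ^ 2 + π.im ^ 2 := by
  rw [← h.norm_eq, norm_eq_sq_add_sq]

protected theorem star {p : ℕ} (h : IsSplitPrime p π) : IsSplitPrime p (star π) where
  norm_eq := by rw [Zsqrtd.norm_conj, h.norm_eq]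
  even_im := h.even_im.neg

theorem isCoprime (h : IsSplitPrime p π) : IsCoprime π.re π.im :=
  isCoprime_of_sq_add_mul_sq_eq_prime (n := 1) Fact.out (by rw [one_mul, h.sq_add_sq])

theorem odd_re (h : IsSplitPrime p π) : Odd π.re := by
  by_contra hre
  exact Int.prime_two.not_isUnit
    (h.isCoprime.isUnit_of_dvd' (Int.not_odd_iff_even.mp hre).two_dvd h.even_im.two_dvd)

theorem mod_four (h : IsSplitPrime p π) : p % 4 = 1 := by
  obtain ⟨m, hm⟩ := h.odd_re
  obtain ⟨k, hk⟩ := h.even_im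
  have hp : (p : ℤ) = 4 * (m ^ 2 + m + k ^ 2) + 1 := by rw [h.sq_add_sq, hm, hk]; ring
  omega

protected theorem two_ne_zero (h : IsSplitPrime p π) : (2 : ZMod p) ≠ 0 := by
  have h4 := h.mod_four
  exact Ring.two_ne_zero (by rw [ZMod.ringChar_zmod_n]; omega)

theorem im_ne_zero (h : IsSplitPrime p π) : (π.im : ZMod p) ≠ 0 := by
  intro him
  have hre : (π.re : ZMod p) ^ 2 = 0 := by
    have hp := congrArg (Int.cast : ℤ → ZMod p) h.sq_add_sq
    push_cast at hp
    rw [← CharP.cast_eq_zero (ZMod p) p, hp, him]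
    ring
  exact intCast_ne_zero_of_isCoprime p h.isCoprime.symm
    ((ZMod.intCast_zmod_eq_zero_iff_dvd _ _).mp (pow_eq_zero_iff (by norm_num) |>.mp hre)) him

theorem re_add_im_mul_imagResidue (h : IsSplitPrime p π) :
    (π.re : ZMod p) + π.im * imagResidue p π = 0 := by
  rw [imagResidue, mul_div_cancel₀ _ h.im_ne_zero, add_neg_cancel]

theorem imagResidue_sq (h : IsSplitPrime p π) : imagResidue p π ^ 2 = -1 := by
  have hp := congrArg (Int.cast : ℤ → ZMod p) h.sq_add_sq
  push_cast at hp
  rw [CharP.cast_eq_zero] at hp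
  rw [imagResidue, div_pow, div_eq_iff (pow_ne_zero 2 h.im_ne_zero)]
  linear_combination -hp

theorem isPrimitiveRoot_imagResidue (h : IsSplitPrime p π) :
    IsPrimitiveRoot (imagResidue p π) 4 :=
  isPrimitiveRoot_four_of_sq_eq_neg_one h.imagResidue_sq h.two_ne_zero

/-- Reduction modulo the split prime `π`. -/
noncomputable def reduction (h : IsSplitPrime p π) : GaussianInt →+* ZMod p :=
  gaussianEval h.imagResidue_sq

theorem reduction_apply (h : IsSplitPrime p π) (α : GaussianInt) :
    h.reduction α = α.re + α.im * imagResidue p π := rfl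

theorem reduction_eq_zero_iff (h : IsSplitPrime p π) {α : GaussianInt} :
    h.reduction α = 0 ↔ π ∣ α := by
  refine ⟨fun hα => ?_, fun ⟨β, hβ⟩ => ?_⟩
  · have hπ := h.re_add_im_mul_imagResidue
    have hI := h.imagResidue_sq
    rw [reduction_apply] at hα
    have hdvd : ((p : ℤ) : GaussianInt) ∣ star π * α := by
      simp only [Zsqrtd.intCast_dvd, Zsqrtd.re_mul, Zsqrtd.im_mul, Zsqrtd.re_star, Zsqrtd.im_star,
        ← ZMod.intCast_zmod_eq_zero_iff_dvd]
      push_cast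
      constructor
      · linear_combination (α.re : ZMod p) * hπ - π.im * imagResidue p π * hα + π.im * α.im * hI
      · linear_combination (α.im : ZMod p) * hπ - π.im * hα
    rw [← h.norm_eq, Zsqrtd.norm_eq_mul_conj, mul_comm] at hdvd
    refine (mul_dvd_mul_iff_left ?_).mp hdvd
    exact star_ne_zero.mpr fun h0 => h.im_ne_zero (by rw [h0, Zsqrtd.im_zero, Int.cast_zero])
  · rw [hβ, map_mul, reduction_apply, h.re_add_im_mul_imagResidue, zero_mul]

theorem eq_or_eq_neg_of_dvd (h : IsSplitPrime p π) {ρ : GaussianInt} (hρ : IsSplitPrime p ρ)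
    (hdvd : π ∣ ρ) : ρ = π ∨ ρ = -π := by
  obtain ⟨u, rfl⟩ := hdvd
  have hnorm : u.norm = 1 := by
    refine mul_left_cancel₀ (Nat.cast_ne_zero.mpr (NeZero.ne p)) ((?_ : (p : ℤ) * _ = _))
    nth_rw 1 [mul_one, ← h.norm_eq, ← Zsqrtd.norm_mul, hρ.norm_eq]
  have him : Even u.im := by
    have heven : Even (π.re * u.im) := by
      have := hρ.even_im.sub (h.even_im.mul_right u.re)
      rwa [Zsqrtd.im_mul, add_sub_cancel_right] at this
    exact (Int.even_mul.mp heven).resolve_left (Int.not_even_iff_odd.mpr h.odd_re)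
  rcases eq_one_or_eq_neg_one_of_norm_eq_one him hnorm with rfl | rfl
  · exact Or.inl (mul_one π)
  · exact Or.inr (mul_neg_one π)

theorem exists_of_mod_four (hp : p % 4 = 1) : ∃ π, IsSplitPrime p π := by
  obtain ⟨a, b, hab⟩ := Nat.Prime.sq_add_sq (p := p) (by omega)
  wlog hb : Even b generalizing a b
  · refine this b a (by rw [← hab, add_comm]) ?_
    have hodd : Odd (a ^ 2 + b ^ 2) := by rw [hab, Nat.odd_iff]; omega
    have := (Nat.even_add.not.mp (Nat.not_even_iff_odd.mpr hodd))
    simp only [Nat.even_pow' (show 2 ≠ 0 by norm_num)] at this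
    tauto
  · exact ⟨⟨a, b⟩, by rw [norm_eq_sq_add_sq, ← hab]; push_cast; rfl,
      (Int.even_coe_nat b).mpr hb⟩

theorem pow_quarter_pow_four (h : IsSplitPrime p π) {n : ZMod p} (hn : n ≠ 0) :
    (n ^ ((p - 1) / 4)) ^ 4 = 1 := by
  rw [← pow_mul, Nat.div_mul_cancel (by have := h.mod_four; omega)]
  exact ZMod.pow_card_sub_one_eq_one hn

theorem imagResidue_pow_quarticChar (h : IsSplitPrime p π) {n : ZMod p} (hn : n ≠ 0) :
    imagResidue p π ^ (quarticChar p π n).val = n ^ ((p - 1) / 4) :=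
  pow_rootLog h.isPrimitiveRoot_imagResidue (h.pow_quarter_pow_four hn)

theorem quarticChar_mul (h : IsSplitPrime p π) {m n : ZMod p} (hm : m ≠ 0) (hn : n ≠ 0) :
    quarticChar p π (m * n) = quarticChar p π m + quarticChar p π n := by
  rw [quarticChar, mul_pow, rootLog_mul h.isPrimitiveRoot_imagResidue (h.pow_quarter_pow_four hm)
    (h.pow_quarter_pow_four hn), quarticChar, quarticChar]

theorem quarticChar_one (h : IsSplitPrime p π) : quarticChar p π 1 = 0 := by
  rw [quarticChar, one_pow, rootLog_one h.isPrimitiveRoot_imagResidue]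

theorem quarticChar_neg_one (h : IsSplitPrime p π) :
    quarticChar p π (-1) = 2 * ((p - 1) / 4 : ℕ) := by
  refine rootLog_eq h.isPrimitiveRoot_imagResidue ?_
  rw [← Nat.cast_two, ← Nat.cast_mul, pow_val_natCast h.isPrimitiveRoot_imagResidue.pow_eq_one,
    pow_mul, h.imagResidue_sq]

/-- The quartic residue character modulo a split prime, with values in the Gaussian integers. -/
noncomputable def mulChar (h : IsSplitPrime p π) : MulChar (ZMod p) GaussianInt where
  toFun n := if n = 0 then 0 else (⟨0, 1⟩ : GaussianInt) ^ (quarticChar p π n).val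
  map_one' := by rw [if_neg one_ne_zero, h.quarticChar_one, ZMod.val_zero, pow_zero]
  map_mul' m n := by
    by_cases hm : m = 0
    · rw [if_pos hm, if_pos (by rw [hm, zero_mul]), zero_mul]
    by_cases hn : n = 0
    · rw [if_pos hn, if_pos (by rw [hn, mul_zero]), mul_zero]
    rw [if_neg (mul_ne_zero hm hn), if_neg hm, if_neg hn, h.quarticChar_mul hm hn,
      pow_val_add (by decide)]
  map_nonunit' n hn := if_pos (by rwa [isUnit_iff_ne_zero, not_not] at hn)

theorem mulChar_apply (h : IsSplitPrime p π) {n : ZMod p} (hn : n ≠ 0) :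
    h.mulChar n = (⟨0, 1⟩ : GaussianInt) ^ (quarticChar p π n).val := if_neg hn

theorem reduction_mulChar (h : IsSplitPrime p π) (n : ZMod p) :
    h.reduction (h.mulChar n) = n ^ ((p - 1) / 4) := by
  by_cases hn : n = 0
  · have h4 := h.mod_four
    have h2 := (Fact.out : p.Prime).two_le
    rw [hn, MulChar.map_zero, map_zero, zero_pow (by omega)]
  · rw [h.mulChar_apply hn, map_pow, reduction_apply, Int.cast_zero, Int.cast_one, zero_add,
      one_mul, h.imagResidue_pow_quarticChar hn]

theorem mulChar_pow_four (h : IsSplitPrime p π) : h.mulChar ^ 4 = 1 := by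
  refine MulChar.ext fun n => ?_
  rw [MulChar.pow_apply_coe, h.mulChar_apply n.ne_zero, ← pow_mul, mul_comm, pow_mul,
    show (⟨0, 1⟩ : GaussianInt) ^ 4 = 1 by decide, one_pow, MulChar.one_apply_coe]

theorem mulChar_inv (h : IsSplitPrime p π) :
    h.mulChar⁻¹ = h.mulChar.ringHomComp (starRingEnd GaussianInt) := by
  refine (eq_inv_of_mul_eq_one_right (MulChar.ext fun n => ?_)).symm
  rw [MulChar.mul_apply, MulChar.ringHomComp_apply, h.mulChar_apply n.ne_zero, map_pow, ← mul_pow,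
    show (⟨0, 1⟩ : GaussianInt) * (starRingEnd GaussianInt) ⟨0, 1⟩ = 1 by decide, one_pow,
    MulChar.one_apply_coe]

theorem exists_mulChar_sq_eq_neg_one (h : IsSplitPrime p π) :
    ∃ n : (ZMod p)ˣ, h.mulChar n ^ 2 = -1 := by
  have hchar : ringChar (ZMod p) ≠ 2 := by
    have h4 := h.mod_four
    rw [ZMod.ringChar_zmod_n]; omega
  obtain ⟨n, hn⟩ := FiniteField.exists_nonsquare hchar
  have hn0 : n ≠ 0 := by rintro rfl; exact hn IsSquare.zero
  have hred : h.reduction (h.mulChar n ^ 2) ≠ 1 := by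
    have hexp : (p - 1) / 4 * 2 = Fintype.card (ZMod p) / 2 := by
      have h4 := h.mod_four
      rw [ZMod.card]; omega
    rwa [map_pow, h.reduction_mulChar, ← pow_mul, hexp, Ne, ← FiniteField.isSquare_iff hchar hn0]
  have hfour : (h.mulChar n ^ 2) ^ 2 = 1 ^ 2 := by
    rw [← pow_mul, ← MulChar.pow_apply' _ (by norm_num), h.mulChar_pow_four,
      MulChar.one_apply hn0.isUnit, one_pow]
  refine ⟨Units.mk0 n hn0, (sq_eq_sq_iff_eq_or_eq_neg.mp hfour).resolve_left fun h1 => hred ?_⟩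
  rw [h1, map_one]

theorem mulChar_ringHomComp_mul_self_ne_one (h : IsSplitPrime p π) {R : Type*} [CommRing R]
    (h2 : (2 : R) ≠ 0) (f : GaussianInt →+* R) :
    h.mulChar.ringHomComp f * h.mulChar.ringHomComp f ≠ 1 := by
  obtain ⟨n, hn⟩ := h.exists_mulChar_sq_eq_neg_one
  intro h1
  have happ := congrArg (fun χ : MulChar (ZMod p) R => χ n) h1
  simp only [MulChar.mul_apply, MulChar.one_apply_coe, MulChar.ringHomComp_apply] at happ
  rw [← map_mul, ← sq, hn, map_neg, map_one] at happ
  exact h2 (by linear_combination -happ)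

theorem mulChar_ringHomComp_ne_one (h : IsSplitPrime p π) {R : Type*} [CommRing R]
    (h2 : (2 : R) ≠ 0) (f : GaussianInt →+* R) : h.mulChar.ringHomComp f ≠ 1 := fun h1 =>
  h.mulChar_ringHomComp_mul_self_ne_one h2 f (by rw [h1, one_mul])

theorem sum_pow_mul_one_sub_pow_eq_zero (h : IsSplitPrime p π) :
    ∑ n : ZMod p, n ^ ((p - 1) / 4) * (1 - n) ^ ((p - 1) / 4) = 0 := by
  have h4 := h.mod_four
  have h2 := (Fact.out : p.Prime).two_le
  set k := (p - 1) / 4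
  have hexp (n : ZMod p) : n ^ k * (1 - n) ^ k =
      ∑ i ∈ Finset.range (k + 1), ((-1) ^ i * (k.choose i : ZMod p)) * n ^ (k + i) := by
    rw [sub_eq_neg_add, add_pow, Finset.mul_sum]
    refine Finset.sum_congr rfl fun i _ => ?_
    rw [neg_pow, one_pow, pow_add]
    ring
  simp only [hexp]
  rw [Finset.sum_comm]
  refine Finset.sum_eq_zero fun i hi => ?_
  have hik : i ≤ k := Finset.mem_range_succ_iff.mp hi
  rw [← Finset.mul_sum, FiniteField.sum_pow_lt_card_sub_one _ _ (by rw [ZMod.card]; omega),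
    mul_zero]

theorem dvd_jacobiSum (h : IsSplitPrime p π) : π ∣ jacobiSum h.mulChar h.mulChar := by
  rw [← h.reduction_eq_zero_iff, jacobiSum, map_sum]
  simp only [map_mul, h.reduction_mulChar]
  exact h.sum_pow_mul_one_sub_pow_eq_zero

theorem norm_jacobiSum (h : IsSplitPrime p π) : (jacobiSum h.mulChar h.mulChar).norm = p := by
  set χ := h.mulChar.ringHomComp GaussianInt.toComplex with hχ
  have hmul : jacobiSum χ χ * jacobiSum χ⁻¹ χ⁻¹ = Fintype.card (ZMod p) :=
    jacobiSum_mul_jacobiSum_inv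
      (by rw [ZMod.ringChar_zmod_n, ringChar.eq_zero]; exact (NeZero.ne p).symm)
      (h.mulChar_ringHomComp_ne_one two_ne_zero _) (h.mulChar_ringHomComp_ne_one two_ne_zero _)
      (h.mulChar_ringHomComp_mul_self_ne_one two_ne_zero _)
  rw [hχ, MulChar.ringHomComp_inv, h.mulChar_inv, jacobiSum_ringHomComp, jacobiSum_ringHomComp,
    jacobiSum_ringHomComp, ← map_mul, ZMod.card, ← map_natCast GaussianInt.toComplex,
    starRingEnd_apply, ← Zsqrtd.norm_eq_mul_conj] at hmul
  exact_mod_cast GaussianInt.toComplex_injective hmul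

theorem even_im_jacobiSum (h : IsSplitPrime p π) : Even (jacobiSum h.mulChar h.mulChar).im := by
  have hI : IsPrimitiveRoot (⟨0, 1⟩ : GaussianInt) 4 :=
    isPrimitiveRoot_four_of_sq_eq_neg_one (by decide) (by decide)
  obtain ⟨z, -, hz⟩ := exists_jacobiSum_eq_neg_one_add (n := 4) (by norm_num)
    h.mulChar_pow_four h.mulChar_pow_four
    (by rw [ZMod.card]; have := h.mod_four; omega) hI
  rw [hz, show ((⟨0, 1⟩ : GaussianInt) - 1) ^ 2 = ⟨0, -2⟩ by decide, even_iff_two_dvd]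
  refine ⟨-z.re, ?_⟩
  simp only [Zsqrtd.im_add, Zsqrtd.im_neg, Zsqrtd.im_one, Zsqrtd.im_mul]
  ring

theorem jacobiSum_eq_or_eq_neg (h : IsSplitPrime p π) :
    jacobiSum h.mulChar h.mulChar = π ∨ jacobiSum h.mulChar h.mulChar = -π :=
  h.eq_or_eq_neg_of_dvd ⟨h.norm_jacobiSum, h.even_im_jacobiSum⟩ h.dvd_jacobiSum

end IsSplitPrime

/-! ### Quartic reciprocity for rational primes -/

section ResidueSymbol

variable (ℓ : ℕ) [Fact ℓ.Prime]

/-- A square root of `-1` in characteristic `ℓ`. -/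
noncomputable def rootNegOne : AlgebraicClosure (ZMod ℓ) :=
  (IsAlgClosed.exists_pow_nat_eq (-1) two_pos).choose

theorem rootNegOne_sq : rootNegOne ℓ ^ 2 = -1 :=
  (IsAlgClosed.exists_pow_nat_eq (-1) two_pos).choose_spec

/-- The ring homomorphism from the Gaussian integers to an algebraic closure of `ZMod ℓ` sending
`i` to `rootNegOne ℓ`. -/
noncomputable def residueHom : GaussianInt →+* AlgebraicClosure (ZMod ℓ) :=
  gaussianEval (rootNegOne_sq ℓ)

theorem residueHom_apply (α : GaussianInt) :
    residueHom ℓ α = α.re + α.im * rootNegOne ℓ := rfl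

theorem residueHom_mul_star (α : GaussianInt) :
    residueHom ℓ α * residueHom ℓ (star α) = (α.norm : ℤ) :=
  gaussianEval_mul_star _ α

/-- The odd number `n`, with the sign that makes it congruent to `1` modulo `4`. -/
def signedNat (n : ℕ) : ℤ := ZMod.χ₄ n * n

theorem signedNat_mul (m n : ℕ) : signedNat (m * n) = signedNat m * signedNat n := by
  simp only [signedNat, Nat.cast_mul, map_mul]
  ring

theorem signedNat_of_mod_four_eq_one {n : ℕ} (hn : n % 4 = 1) : signedNat n = n := by
  rw [signedNat, ZMod.χ₄_nat_one_mod_four hn, one_mul]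

theorem signedNat_of_mod_four_eq_three {n : ℕ} (hn : n % 4 = 3) : signedNat n = -n := by
  rw [signedNat, ZMod.χ₄_nat_three_mod_four hn, neg_one_mul]

theorem signedNat_mod_four {n : ℕ} (hn : n % 2 = 1) : signedNat n % 4 = 1 := by
  rcases Nat.odd_mod_four_iff.mp hn with h | h
  · rw [signedNat_of_mod_four_eq_one h]; omega
  · rw [signedNat_of_mod_four_eq_three h]; omega

theorem signedNat_natAbs {n : ℤ} (hn : n % 4 = 1) : signedNat n.natAbs = n := by
  rcases Nat.odd_mod_four_iff.mp (show n.natAbs % 2 = 1 by omega) with h | h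
  · rw [signedNat_of_mod_four_eq_one h]; omega
  · rw [signedNat_of_mod_four_eq_three h]; omega

/-- The power of `α / ᾱ` in characteristic `ℓ` that is a fourth root of unity when `α` is prime to
`ℓ`. -/
noncomputable def symbolRoot (α : GaussianInt) : AlgebraicClosure (ZMod ℓ) :=
  (residueHom ℓ α / residueHom ℓ (star α)) ^ ((signedNat ℓ - 1) / 4)

/-- The exponent of the quartic residue symbol of `α` modulo the odd rational prime `ℓ`. It does not
depend on the choice of `rootNegOne ℓ`, which serves both to reduce `α` and as base of the
logarithm. -/
noncomputable def quarticSymbol (α : GaussianInt) : ZMod 4 :=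
  rootLog 4 (rootNegOne ℓ) (symbolRoot ℓ α)

variable {ℓ}

theorem rootNegOne_pow_four : rootNegOne ℓ ^ 4 = 1 := by
  linear_combination (rootNegOne ℓ ^ 2 - 1) * rootNegOne_sq ℓ

theorem residueHom_pow_of_mod_four_eq_one (h : ℓ % 4 = 1) (α : GaussianInt) :
    residueHom ℓ α ^ ℓ = residueHom ℓ α := by
  refine RingHom.congr_fun (Zsqrtd.hom_ext ((frobenius _ ℓ).comp (residueHom ℓ)) _ ?_) α
  simp only [RingHom.comp_apply, frobenius_def, residueHom_apply, Zsqrtd.re_sqrtd, Zsqrtd.im_sqrtd,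
    Int.cast_zero, Int.cast_one, zero_add, one_mul]
  rw [pow_eq_pow_mod _ rootNegOne_pow_four, h, pow_one]

theorem residueHom_pow_of_mod_four_eq_three (h : ℓ % 4 = 3) (α : GaussianInt) :
    residueHom ℓ α ^ ℓ = residueHom ℓ (star α) := by
  refine RingHom.congr_fun (Zsqrtd.hom_ext ((frobenius _ ℓ).comp (residueHom ℓ))
    ((residueHom ℓ).comp (starRingEnd GaussianInt)) ?_) α
  simp only [RingHom.comp_apply, frobenius_def, residueHom_apply, starRingEnd_apply,
    Zsqrtd.re_star, Zsqrtd.im_star, Zsqrtd.re_sqrtd, Zsqrtd.im_sqrtd, Int.cast_zero, Int.cast_one,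
    Int.cast_neg, zero_add, one_mul]
  rw [pow_eq_pow_mod _ rootNegOne_pow_four, h]
  linear_combination rootNegOne ℓ * rootNegOne_sq ℓ

theorem residueHom_ne_zero {α : GaussianInt} (h : IsCoprime (ℓ : ℤ) α.norm) :
    residueHom ℓ α ≠ 0 := by
  have hnorm := intCast_ne_zero_of_isCoprime (R := AlgebraicClosure (ZMod ℓ)) ℓ h.symm dvd_rfl
  rw [← residueHom_mul_star] at hnorm
  exact left_ne_zero_of_mul hnorm

theorem residueHom_star_ne_zero {α : GaussianInt} (h : IsCoprime (ℓ : ℤ) α.norm) :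
    residueHom ℓ (star α) ≠ 0 :=
  residueHom_ne_zero (by rwa [Zsqrtd.norm_conj])

theorem two_ne_zero_algebraicClosure (hℓ : ℓ % 2 = 1) : (2 : AlgebraicClosure (ZMod ℓ)) ≠ 0 :=
  Ring.two_ne_zero (by rw [ringChar.eq _ ℓ]; omega)

theorem isPrimitiveRoot_rootNegOne (hℓ : ℓ % 2 = 1) : IsPrimitiveRoot (rootNegOne ℓ) 4 :=
  isPrimitiveRoot_four_of_sq_eq_neg_one (rootNegOne_sq ℓ) (two_ne_zero_algebraicClosure hℓ)

theorem symbolRoot_of_mod_four_eq_one (h : ℓ % 4 = 1) (α : GaussianInt) :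
    symbolRoot ℓ α = (residueHom ℓ α / residueHom ℓ (star α)) ^ (ℓ / 4) := by
  rw [symbolRoot, signedNat_of_mod_four_eq_one h, show ((ℓ : ℤ) - 1) / 4 = (ℓ / 4 : ℕ) by omega,
    zpow_natCast]

theorem symbolRoot_of_mod_four_eq_three (h : ℓ % 4 = 3) (α : GaussianInt) :
    symbolRoot ℓ α = (residueHom ℓ (star α) / residueHom ℓ α) ^ ((ℓ + 1) / 4) := by
  rw [symbolRoot, signedNat_of_mod_four_eq_three h,
    show (-(ℓ : ℤ) - 1) / 4 = -((ℓ + 1) / 4 : ℕ) by omega, zpow_neg, zpow_natCast, ← inv_pow,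
    inv_div]

theorem symbolRoot_pow_four (hℓ : ℓ % 2 = 1) {α : GaussianInt} (h : IsCoprime (ℓ : ℤ) α.norm) :
    symbolRoot ℓ α ^ 4 = 1 := by
  have h1 := residueHom_ne_zero h
  have h2 := residueHom_star_ne_zero h
  rcases Nat.odd_mod_four_iff.mp hℓ with h4 | h4
  · refine mul_right_cancel₀ (div_ne_zero h1 h2) ?_
    rw [symbolRoot_of_mod_four_eq_one h4, ← pow_mul, ← pow_succ, one_mul,
      show ℓ / 4 * 4 + 1 = ℓ by omega, div_pow, residueHom_pow_of_mod_four_eq_one h4,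
      residueHom_pow_of_mod_four_eq_one h4]
  · rw [symbolRoot_of_mod_four_eq_three h4, ← pow_mul, show (ℓ + 1) / 4 * 4 = ℓ + 1 by omega,
      pow_succ, div_pow, residueHom_pow_of_mod_four_eq_three h4,
      residueHom_pow_of_mod_four_eq_three h4, star_star, div_mul_div_cancel₀ h2, div_self h1]

theorem quarticSymbol_mul (hℓ : ℓ % 2 = 1) {α β : GaussianInt} (hα : IsCoprime (ℓ : ℤ) α.norm)
    (hβ : IsCoprime (ℓ : ℤ) β.norm) :
    quarticSymbol ℓ (α * β) = quarticSymbol ℓ α + quarticSymbol ℓ β := by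
  have hmul : symbolRoot ℓ (α * β) = symbolRoot ℓ α * symbolRoot ℓ β := by
    simp only [symbolRoot]
    rw [← mul_zpow, star_mul, map_mul, map_mul, mul_comm (residueHom ℓ (star β)),
      mul_div_mul_comm]
  rw [quarticSymbol, hmul, rootLog_mul (isPrimitiveRoot_rootNegOne hℓ) (symbolRoot_pow_four hℓ hα)
    (symbolRoot_pow_four hℓ hβ), quarticSymbol, quarticSymbol]

theorem quarticSymbol_congr {α β : GaussianInt} (h : (ℓ : GaussianInt) ∣ α - β) :
    quarticSymbol ℓ α = quarticSymbol ℓ β := by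
  have hmap {α β : GaussianInt} (h : (ℓ : GaussianInt) ∣ α - β) :
      residueHom ℓ α = residueHom ℓ β := by
    obtain ⟨γ, hγ⟩ := h
    rw [← sub_eq_zero, ← map_sub, hγ, map_mul, map_natCast, CharP.cast_eq_zero, zero_mul]
  have hstar : (ℓ : GaussianInt) ∣ star α - star β := by
    obtain ⟨γ, hγ⟩ := h
    exact ⟨star γ, by rw [← star_sub, hγ, star_mul, star_natCast, mul_comm]⟩
  rw [quarticSymbol, symbolRoot, hmap h, hmap hstar, quarticSymbol, symbolRoot]

theorem quarticSymbol_intCast (hℓ : ℓ % 2 = 1) {n : ℤ} (h : IsCoprime (ℓ : ℤ) n) :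
    quarticSymbol ℓ n = 0 := by
  have h0 : (n : AlgebraicClosure (ZMod ℓ)) ≠ 0 := intCast_ne_zero_of_isCoprime ℓ h.symm dvd_rfl
  rw [quarticSymbol, symbolRoot, star_intCast, map_intCast, div_self h0, one_zpow,
    rootLog_one (isPrimitiveRoot_rootNegOne hℓ)]

theorem quarticSymbol_one_add_I (hℓ : ℓ % 2 = 1) :
    quarticSymbol ℓ ⟨1, 1⟩ = ((signedNat ℓ - 1) / 4 : ℤ) := by
  have hcop : IsCoprime (ℓ : ℤ) (⟨1, 1⟩ : GaussianInt).norm := by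
    rw [show (⟨1, 1⟩ : GaussianInt).norm = 2 by decide]
    exact Nat.isCoprime_iff_coprime.mpr (Nat.coprime_two_right.mpr (Nat.odd_iff.mpr hℓ))
  have hroot : residueHom ℓ ⟨1, 1⟩ / residueHom ℓ (star ⟨1, 1⟩) = rootNegOne ℓ := by
    rw [div_eq_iff (residueHom_star_ne_zero hcop), residueHom_apply, residueHom_apply,
      Zsqrtd.re_star, Zsqrtd.im_star, Int.cast_neg, Int.cast_one]
    linear_combination rootNegOne_sq ℓ
  rw [quarticSymbol, symbolRoot, hroot, rootLog_zpow (isPrimitiveRoot_rootNegOne hℓ)]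

end ResidueSymbol

section Reciprocity

theorem exists_isPrimitive_addChar_zmod (K : Type*) [Field K] [IsAlgClosed K] (n : ℕ) [NeZero n]
    [NeZero (n : K)] : ∃ ψ : AddChar (ZMod n) K, ψ.IsPrimitive := by
  obtain ⟨ξ, hξ⟩ := HasEnoughRootsOfUnity.exists_primitiveRoot K n
  exact ⟨_, AddChar.zmodChar_primitive_of_primitive_root n hξ⟩

theorem gaussSum_pow_char {R K : Type*} [CommRing R] [Fintype R] [CommRing K] (ℓ : ℕ)
    [Fact ℓ.Prime] [CharP K ℓ] (hℓ : IsUnit (ℓ : R)) (χ : MulChar R K) (ψ : AddChar R K) :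
    gaussSum χ ψ ^ ℓ = (χ ^ ℓ)⁻¹ ℓ * gaussSum (χ ^ ℓ) ψ := by
  rw [gaussSum_frob, AddChar.pow_mulShift, ← hℓ.unit_spec, gaussSum_mulShift_eq]

namespace IsSplitPrime

variable {p : ℕ} [Fact p.Prime] {π : GaussianInt} {ℓ : ℕ} [Fact ℓ.Prime]

variable (ℓ) in
/-- The quartic residue character modulo a split prime, with values in characteristic `ℓ`. -/
noncomputable def modChar (h : IsSplitPrime p π) : MulChar (ZMod p) (AlgebraicClosure (ZMod ℓ)) :=
  h.mulChar.ringHomComp (residueHom ℓ)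

theorem modChar_pow_four (h : IsSplitPrime p π) : h.modChar ℓ ^ 4 = 1 := by
  rw [modChar, MulChar.ringHomComp_pow, h.mulChar_pow_four, MulChar.ringHomComp_one]

theorem modChar_mul_self_ne_one (h : IsSplitPrime p π) (hℓ : ℓ % 2 = 1) :
    h.modChar ℓ * h.modChar ℓ ≠ 1 :=
  h.mulChar_ringHomComp_mul_self_ne_one (two_ne_zero_algebraicClosure hℓ) (residueHom ℓ)

theorem modChar_ne_one (h : IsSplitPrime p π) (hℓ : ℓ % 2 = 1) : h.modChar ℓ ≠ 1 :=
  h.mulChar_ringHomComp_ne_one (two_ne_zero_algebraicClosure hℓ) (residueHom ℓ)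

theorem isQuadratic_modChar_mul_self (h : IsSplitPrime p π) :
    (h.modChar ℓ * h.modChar ℓ).IsQuadratic := by
  intro n
  by_cases hn : n = 0
  · exact Or.inl (by rw [hn, MulChar.map_zero])
  · have hone : (h.modChar ℓ n * h.modChar ℓ n) ^ 2 = 1 ^ 2 := by
      rw [one_pow,
        ← MulChar.one_apply (R' := AlgebraicClosure (ZMod ℓ)) (isUnit_iff_ne_zero.mpr hn),
        ← h.modChar_pow_four, MulChar.pow_apply' _ four_ne_zero]
      ring
    exact Or.inr (sq_eq_sq_iff_eq_or_eq_neg.mp hone)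

theorem gaussSum_modChar_pow_four (h : IsSplitPrime p π) (hℓ : ℓ % 2 = 1)
    {ψ : AddChar (ZMod p) (AlgebraicClosure (ZMod ℓ))} (hψ : ψ.IsPrimitive) :
    gaussSum (h.modChar ℓ) ψ ^ 4 = residueHom ℓ π ^ 3 * residueHom ℓ (star π) := by
  have hne := h.modChar_mul_self_ne_one hℓ
  set χ := h.modChar ℓ with hχ
  have hp : (Fintype.card (ZMod p) : AlgebraicClosure (ZMod ℓ)) =
      residueHom ℓ π * residueHom ℓ (star π) := by
    rw [ZMod.card, residueHom_mul_star, h.norm_eq, Int.cast_natCast]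
  have hquad : gaussSum (χ * χ) ψ ^ 2 = residueHom ℓ π * residueHom ℓ (star π) := by
    rw [gaussSum_sq hne h.isQuadratic_modChar_mul_self hψ, MulChar.mul_apply, ← map_mul,
      neg_one_mul, neg_neg, map_one, one_mul, hp]
  have hjac : jacobiSum χ χ ^ 2 = residueHom ℓ π ^ 2 := by
    rw [hχ, modChar, jacobiSum_ringHomComp]
    rcases h.jacobiSum_eq_or_eq_neg with hJ | hJ
    · rw [hJ]
    · rw [hJ, map_neg, neg_sq]
  calc gaussSum χ ψ ^ 4 = (gaussSum χ ψ * gaussSum χ ψ) ^ 2 := by ring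
    _ = gaussSum (χ * χ) ψ ^ 2 * jacobiSum χ χ ^ 2 := by
      rw [← jacobiSum_mul_nontrivial hne ψ, mul_pow]
    _ = _ := by rw [hquad, hjac]; ring

theorem isCoprime_norm (h : IsSplitPrime p π) (hp : ℓ ≠ p) : IsCoprime (ℓ : ℤ) π.norm := by
  rw [h.norm_eq, Nat.isCoprime_iff_coprime]
  exact (Nat.coprime_primes Fact.out Fact.out).mpr hp

theorem modChar_natCast_of_mod_four_eq_one (h : IsSplitPrime p π) (h4 : ℓ % 4 = 1)
    (hu : IsUnit (ℓ : ZMod p)) (hp : ℓ ≠ p) {ψ : AddChar (ZMod p) (AlgebraicClosure (ZMod ℓ))}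
    (hψ : ψ.IsPrimitive) : h.modChar ℓ ℓ = symbolRoot ℓ π := by
  have hl := residueHom_ne_zero (h.isCoprime_norm hp)
  have hr := residueHom_star_ne_zero (h.isCoprime_norm hp)
  have hexp {M : Type} [Monoid M] (a : M) : a ^ ℓ = (a ^ 4) ^ (ℓ / 4) * a := by
    rw [← pow_mul, ← pow_succ, show 4 * (ℓ / 4) + 1 = ℓ by omega]
  have hgauss := h.gaussSum_modChar_pow_four (by omega) hψ
  set χ := h.modChar ℓ
  have hfrob : (gaussSum χ ψ ^ 4) ^ (ℓ / 4) = χ⁻¹ ℓ := by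
    have hpow := gaussSum_pow_char ℓ hu χ ψ
    rw [hexp χ, h.modChar_pow_four, one_pow, one_mul, hexp] at hpow
    refine mul_right_cancel₀ (pow_ne_zero_iff four_ne_zero |>.mp ?_) hpow
    rw [hgauss]
    exact mul_ne_zero (pow_ne_zero 3 hl) hr
  have hπ : (residueHom ℓ π ^ 4) ^ (ℓ / 4) = 1 := by
    refine mul_right_cancel₀ hl ?_
    rw [← hexp, residueHom_pow_of_mod_four_eq_one h4, one_mul]
  have hinv : χ⁻¹ ℓ * χ ℓ = 1 := by rw [← MulChar.mul_apply, inv_mul_cancel, MulChar.one_apply hu]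
  refine mul_left_cancel₀ (left_ne_zero_of_mul_eq_one hinv) (hinv.trans ?_)
  rw [symbolRoot_of_mod_four_eq_one h4, ← hfrob, hgauss, ← mul_pow, ← hπ]
  congr 1
  field_simp

theorem modChar_neg_natCast_of_mod_four_eq_three (h : IsSplitPrime p π) (h4 : ℓ % 4 = 3)
    (hu : IsUnit (ℓ : ZMod p)) (hp : ℓ ≠ p) {ψ : AddChar (ZMod p) (AlgebraicClosure (ZMod ℓ))}
    (hψ : ψ.IsPrimitive) : h.modChar ℓ (-ℓ) = symbolRoot ℓ π := by
  have hl := residueHom_ne_zero (h.isCoprime_norm hp)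
  have hr := residueHom_star_ne_zero (h.isCoprime_norm hp)
  have hexp {M : Type} [Monoid M] (a : M) : a ^ ℓ * a = (a ^ 4) ^ ((ℓ + 1) / 4) := by
    rw [← pow_mul, ← pow_succ, show 4 * ((ℓ + 1) / 4) = ℓ + 1 by omega]
  have hgauss := h.gaussSum_modChar_pow_four (by omega) hψ
  have hcard := gaussSum_mul_gaussSum_eq_card (h.modChar_ne_one (ℓ := ℓ) (by omega)) hψ
  set χ : MulChar (ZMod p) (AlgebraicClosure (ZMod ℓ)) := h.modChar ℓ with hχ
  rw [ZMod.card, ← Int.cast_natCast, ← h.norm_eq, ← residueHom_mul_star] at hcard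
  have hfrob : (gaussSum χ ψ ^ 4) ^ ((ℓ + 1) / 4) =
      χ (-ℓ) * (residueHom ℓ π * residueHom ℓ (star π)) := by
    have hχℓ : χ ^ ℓ = χ⁻¹ :=
      eq_inv_of_mul_eq_one_left (by rw [hexp, h.modChar_pow_four, one_pow])
    rw [← hexp, gaussSum_pow_char ℓ hu, hχℓ, inv_inv, ← mul_gaussSum_inv_eq_gaussSum χ⁻¹ ψ,
      MulChar.inv_apply', inv_neg_one, ← hcard, neg_eq_neg_one_mul (ℓ : ZMod p), map_mul]
    ring
  have hπ : (residueHom ℓ π ^ 4) ^ ((ℓ + 1) / 4) = residueHom ℓ π * residueHom ℓ (star π) := by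
    rw [← hexp, residueHom_pow_of_mod_four_eq_three h4, mul_comm]
  refine mul_right_cancel₀ (mul_ne_zero hl hr) (hfrob.symm.trans ?_)
  rw [symbolRoot_of_mod_four_eq_three h4, hgauss, ← hπ, ← mul_pow]
  congr 1
  field_simp

theorem modChar_signedNat (h : IsSplitPrime p π) (hℓ : ℓ % 2 = 1) (hp : ℓ ≠ p) :
    h.modChar ℓ (signedNat ℓ : ℤ) = symbolRoot ℓ π := by
  have hu : IsUnit (ℓ : ZMod p) :=
    (ZMod.isUnit_iff_coprime ℓ p).mpr ((Nat.coprime_primes Fact.out Fact.out).mpr hp)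
  have : NeZero (p : AlgebraicClosure (ZMod ℓ)) := ⟨by
    rw [← Int.cast_natCast, ← h.norm_eq]
    exact intCast_ne_zero_of_isCoprime ℓ (h.isCoprime_norm hp).symm dvd_rfl⟩
  obtain ⟨ψ, hψ⟩ := exists_isPrimitive_addChar_zmod (AlgebraicClosure (ZMod ℓ)) p
  rcases Nat.odd_mod_four_iff.mp hℓ with h4 | h4
  · rw [signedNat_of_mod_four_eq_one h4, Int.cast_natCast]
    exact h.modChar_natCast_of_mod_four_eq_one h4 hu hp hψ
  · rw [signedNat_of_mod_four_eq_three h4, Int.cast_neg, Int.cast_natCast]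
    exact h.modChar_neg_natCast_of_mod_four_eq_three h4 hu hp hψ

theorem quarticChar_signedNat (h : IsSplitPrime p π) (hℓ : ℓ % 2 = 1) (hp : ℓ ≠ p) :
    quarticChar p π (signedNat ℓ : ℤ) = quarticSymbol ℓ π := by
  have hroot := h.modChar_signedNat hℓ hp
  have hunit := symbolRoot_pow_four hℓ (h.isCoprime_norm hp)
  have hne : ((signedNat ℓ : ℤ) : ZMod p) ≠ 0 := by
    intro h0
    rw [h0, MulChar.map_zero] at hroot
    rw [← hroot, zero_pow four_ne_zero] at hunit
    exact zero_ne_one hunit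
  refine (rootLog_eq (isPrimitiveRoot_rootNegOne hℓ) ?_).symm
  rw [← hroot, modChar, MulChar.ringHomComp_apply, h.mulChar_apply hne, map_pow, residueHom_apply,
    Int.cast_zero, Int.cast_one, zero_add, one_mul]

end IsSplitPrime

end Reciprocity

/-! ### The quartic Jacobi symbol modulo a rational integer -/

section JacobiSymbol

/-- `quarticSymbol ℓ α`, extended by `0` to all `ℓ` that are not prime. -/
noncomputable def primeSymbol (ℓ : ℕ) (α : GaussianInt) : ZMod 4 :=
  if h : ℓ.Prime then
    haveI : Fact ℓ.Prime := ⟨h⟩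
    quarticSymbol ℓ α
  else 0

/-- The exponent of the quartic Jacobi symbol of the Gaussian integer `α` modulo the odd integer
`n`, as a sum over the prime factorisation of `n`; the sign of `n` is ignored. -/
noncomputable def quarticJacobi (n : ℤ) (α : GaussianInt) : ZMod 4 :=
  n.natAbs.factorization.sum fun ℓ k => (k : ZMod 4) * primeSymbol ℓ α

variable {m n : ℤ} {α β : GaussianInt}

theorem quarticJacobi_natAbs (n : ℤ) (α : GaussianInt) :
    quarticJacobi n.natAbs α = quarticJacobi n α := rfl

theorem quarticJacobi_mul_left (hm : m ≠ 0) (hn : n ≠ 0) (α : GaussianInt) :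
    quarticJacobi (m * n) α = quarticJacobi m α + quarticJacobi n α := by
  rw [quarticJacobi, Int.natAbs_mul,
    Nat.factorization_mul (Int.natAbs_ne_zero.mpr hm) (Int.natAbs_ne_zero.mpr hn)]
  refine Finsupp.sum_add_index' (fun ℓ => ?_) fun ℓ j k => ?_
  · rw [Nat.cast_zero, zero_mul]
  · rw [Nat.cast_add, add_mul]

theorem quarticJacobi_one_left (α : GaussianInt) : quarticJacobi 1 α = 0 := by
  rw [quarticJacobi, Int.natAbs_one, Nat.factorization_one, Finsupp.sum_zero_index]

theorem quarticJacobi_prime (ℓ : ℕ) [hℓ : Fact ℓ.Prime] (α : GaussianInt) :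
    quarticJacobi ℓ α = quarticSymbol ℓ α := by
  rw [quarticJacobi, Int.natAbs_natCast, hℓ.out.factorization,
    Finsupp.sum_single_index (by rw [Nat.cast_zero, zero_mul]), Nat.cast_one, one_mul, primeSymbol,
    dif_pos hℓ.out]

theorem quarticJacobi_eq_sum {S : Finset ℕ} (h : n.natAbs.primeFactors ⊆ S) (α : GaussianInt) :
    quarticJacobi n α = ∑ ℓ ∈ S, (n.natAbs.factorization ℓ : ZMod 4) * quarticJacobi ℓ α := by
  refine (Finsupp.sum_of_support_subset _ (by rwa [Nat.support_factorization]) _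
    fun ℓ _ => by rw [Nat.cast_zero, zero_mul]).trans (Finset.sum_congr rfl fun ℓ _ => ?_)
  by_cases hℓ : ℓ.Prime
  · have : Fact ℓ.Prime := ⟨hℓ⟩
    rw [quarticJacobi_prime, primeSymbol, dif_pos hℓ]
  · rw [Nat.factorization_eq_zero_of_not_prime _ hℓ, Nat.cast_zero, zero_mul, zero_mul]

theorem emod_two_eq_one_of_dvd {m n : ℤ} (h : m ∣ n) (hn : n % 2 = 1) : m % 2 = 1 := by
  obtain ⟨k, rfl⟩ := h
  exact Int.odd_iff.mp (Int.odd_mul.mp (Int.odd_iff.mpr hn)).1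

theorem quarticJacobi_mul (hn : n % 2 = 1) (hα : IsCoprime n α.norm) (hβ : IsCoprime n β.norm) :
    quarticJacobi n (α * β) = quarticJacobi n α + quarticJacobi n β := by
  simp only [quarticJacobi_eq_sum (n := n) subset_rfl, ← Finset.sum_add_distrib, ← mul_add]
  refine Finset.sum_congr rfl fun ℓ hℓ => congrArg _ ?_
  have : Fact ℓ.Prime := ⟨Nat.prime_of_mem_primeFactors hℓ⟩
  have hdvd : (ℓ : ℤ) ∣ n := Int.natCast_dvd.mpr (Nat.dvd_of_mem_primeFactors hℓ)
  have hodd : ℓ % 2 = 1 := by exact_mod_cast emod_two_eq_one_of_dvd hdvd hn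
  simp only [quarticJacobi_prime]
  exact quarticSymbol_mul hodd (hα.of_isCoprime_of_dvd_left hdvd)
    (hβ.of_isCoprime_of_dvd_left hdvd)

theorem quarticJacobi_congr (h : (n : GaussianInt) ∣ α - β) :
    quarticJacobi n α = quarticJacobi n β := by
  rw [quarticJacobi_eq_sum subset_rfl, quarticJacobi_eq_sum (n := n) subset_rfl β]
  refine Finset.sum_congr rfl fun ℓ hℓ => congrArg _ ?_
  have : Fact ℓ.Prime := ⟨Nat.prime_of_mem_primeFactors hℓ⟩
  have hdvd : (ℓ : ℤ) ∣ n := Int.natCast_dvd.mpr (Nat.dvd_of_mem_primeFactors hℓ)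
  rw [quarticJacobi_prime, quarticJacobi_prime]
  refine quarticSymbol_congr (dvd_trans ?_ h)
  exact_mod_cast (Int.cast_dvd_cast (α := GaussianInt) _ _ hdvd)

theorem quarticJacobi_intCast (hn : n % 2 = 1) (h : IsCoprime n m) : quarticJacobi n m = 0 := by
  rw [quarticJacobi_eq_sum subset_rfl]
  refine Finset.sum_eq_zero fun ℓ hℓ => ?_
  have : Fact ℓ.Prime := ⟨Nat.prime_of_mem_primeFactors hℓ⟩
  have hdvd : (ℓ : ℤ) ∣ n := Int.natCast_dvd.mpr (Nat.dvd_of_mem_primeFactors hℓ)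
  have hodd : ℓ % 2 = 1 := by exact_mod_cast emod_two_eq_one_of_dvd hdvd hn
  rw [quarticJacobi_prime, quarticSymbol_intCast hodd (h.of_isCoprime_of_dvd_left hdvd), mul_zero]

theorem quarticJacobi_intCast_mul (hn : n % 2 = 1) (hm : IsCoprime n m)
    (hα : IsCoprime n α.norm) : quarticJacobi n (m * α) = quarticJacobi n α := by
  have hnorm : IsCoprime n (m : GaussianInt).norm := by
    rw [Zsqrtd.norm_intCast]
    exact hm.mul_right hm
  rw [quarticJacobi_mul hn hnorm hα, quarticJacobi_intCast hn hm, zero_add]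

theorem quarticJacobi_star (hn : n % 2 = 1) (hα : IsCoprime n α.norm) :
    quarticJacobi n (star α) = -quarticJacobi n α := by
  rw [eq_neg_iff_add_eq_zero, add_comm,
    ← quarticJacobi_mul hn hα (by rwa [Zsqrtd.norm_conj]), ← Zsqrtd.norm_eq_mul_conj,
    quarticJacobi_intCast hn hα]

theorem intCast_mul_sub_one_div_four (hm : m % 4 = 1) (hn : n % 4 = 1) :
    (((m * n - 1) / 4 : ℤ) : ZMod 4) = ((m - 1) / 4 : ℤ) + ((n - 1) / 4 : ℤ) := by
  obtain ⟨u, rfl⟩ : ∃ u, m = 4 * u + 1 := ⟨m / 4, by omega⟩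
  obtain ⟨v, rfl⟩ : ∃ v, n = 4 * v + 1 := ⟨n / 4, by omega⟩
  rw [show ((4 * u + 1) * (4 * v + 1) - 1) / 4 = 4 * (u * v) + u + v by
      rw [show (4 * u + 1) * (4 * v + 1) - 1 = (4 * (u * v) + u + v) * 4 by ring,
        Int.mul_ediv_cancel _ four_ne_zero],
    show (4 * u + 1 - 1) / 4 = u by omega, show (4 * v + 1 - 1) / 4 = v by omega]
  push_cast
  have h4 : (4 : ZMod 4) = 0 := rfl
  linear_combination (u * v : ZMod 4) * h4

theorem quarticJacobi_natCast_one_add_I {n : ℕ} (hn : n % 2 = 1) :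
    quarticJacobi n ⟨1, 1⟩ = ((signedNat n - 1) / 4 : ℤ) := by
  induction n using Nat.recOnMul with
  | zero => exact absurd hn (by decide)
  | one => rw [Nat.cast_one, quarticJacobi_one_left]; rfl
  | prime ℓ hℓ =>
    have : Fact ℓ.Prime := ⟨hℓ⟩
    rw [quarticJacobi_prime, quarticSymbol_one_add_I hn]
  | mul a b iha ihb =>
    obtain ⟨ha, hb⟩ := Nat.odd_mul.mp (Nat.odd_iff.mpr hn)
    rw [Nat.odd_iff] at ha hb
    rw [Nat.cast_mul, quarticJacobi_mul_left (by omega) (by omega), iha ha, ihb hb, signedNat_mul,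
      intCast_mul_sub_one_div_four (signedNat_mod_four ha) (signedNat_mod_four hb)]

theorem quarticJacobi_one_add_I (hn : n % 4 = 1) :
    quarticJacobi n ⟨1, 1⟩ = ((n - 1) / 4 : ℤ) := by
  rw [← quarticJacobi_natAbs, quarticJacobi_natCast_one_add_I (by omega), signedNat_natAbs hn]

theorem isCoprime_norm_I (n : ℤ) : IsCoprime n (⟨0, 1⟩ : GaussianInt).norm := by
  rw [show (⟨0, 1⟩ : GaussianInt).norm = 1 by decide]
  exact isCoprime_one_right

theorem isCoprime_two (hn : n % 2 = 1) : IsCoprime n 2 :=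
  ⟨1, -(n / 2), by omega⟩

theorem isCoprime_norm_one_add_I (hn : n % 2 = 1) :
    IsCoprime n (⟨1, 1⟩ : GaussianInt).norm := by
  rw [show (⟨1, 1⟩ : GaussianInt).norm = 2 by decide]
  exact isCoprime_two hn

theorem quarticJacobi_I (hn : n % 2 = 1) :
    quarticJacobi n ⟨0, 1⟩ = 2 * quarticJacobi n ⟨1, 1⟩ := by
  have hnorm := isCoprime_norm_one_add_I hn
  rw [two_mul, ← quarticJacobi_mul hn hnorm hnorm,
    show (⟨1, 1⟩ * ⟨1, 1⟩ : GaussianInt) = (2 : ℤ) * ⟨0, 1⟩ by decide,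
    quarticJacobi_intCast_mul hn (isCoprime_two hn) (isCoprime_norm_I n)]

theorem two_mul_quarticJacobi_I (hn : n % 2 = 1) : 2 * quarticJacobi n ⟨0, 1⟩ = 0 := by
  rw [quarticJacobi_I hn, ← mul_assoc]
  exact zero_mul _

theorem two_mul_quarticJacobi_of_dvd {c d x : ℤ} (hn : n % 2 = 1)
    (hdvd : n ∣ c ^ 2 + d ^ 2 - x ^ 2) (hx : IsCoprime n x)
    (hw : IsCoprime n (⟨c, x + d⟩ : GaussianInt).norm) :
    2 * quarticJacobi n ⟨c, x + d⟩ = quarticJacobi n ⟨c, d⟩ + quarticJacobi n ⟨0, 1⟩ := by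
  have hπ : IsCoprime n (⟨c, d⟩ : GaussianInt).norm := by
    obtain ⟨k, hk⟩ := hdvd
    rw [norm_eq_sq_add_sq, show c ^ 2 + d ^ 2 = x ^ 2 + n * k by linear_combination hk]
    exact (hx.pow_right (n := 2)).add_mul_left_right k
  have hcongr : (n : GaussianInt) ∣
      (x : ℤ) * (⟨c, x + d⟩ * ⟨0, 1⟩) - (-1 : ℤ) * (⟨c, d⟩ * star ⟨c, x + d⟩) := by
    convert Int.cast_dvd_cast (α := GaussianInt) _ _ hdvd using 1
    refine Zsqrtd.ext ?_ ?_ <;>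
    simp only [Zsqrtd.re_sub, Zsqrtd.im_sub, Zsqrtd.re_mul, Zsqrtd.im_mul, Zsqrtd.re_intCast,
      Zsqrtd.im_intCast, Zsqrtd.re_star, Zsqrtd.im_star] <;>
    ring
  have hstar : IsCoprime n (star (⟨c, x + d⟩ : GaussianInt)).norm := by rwa [Zsqrtd.norm_conj]
  have hsum := quarticJacobi_congr hcongr
  rw [quarticJacobi_intCast_mul hn hx
      (by rw [Zsqrtd.norm_mul]; exact hw.mul_right (isCoprime_norm_I n)),
    quarticJacobi_intCast_mul hn isCoprime_one_right.neg_right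
      (by rw [Zsqrtd.norm_mul]; exact hπ.mul_right hstar),
    quarticJacobi_mul hn hw (isCoprime_norm_I n), quarticJacobi_mul hn hπ hstar,
    quarticJacobi_star hn hw] at hsum
  linear_combination hsum - two_mul_quarticJacobi_I hn

end JacobiSymbol

namespace IsSplitPrime

variable {p : ℕ} [Fact p.Prime] {π : GaussianInt}

theorem quarticChar_signedNat_eq_quarticJacobi (h : IsSplitPrime p π) {n : ℕ} (hn : n % 2 = 1)
    (hp : IsCoprime (n : ℤ) p) : quarticChar p π (signedNat n : ℤ) = quarticJacobi n π := by
  induction n using Nat.recOnMul with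
  | zero => exact absurd hn (by decide)
  | one =>
    rw [Nat.cast_one, quarticJacobi_one_left, signedNat_of_mod_four_eq_one rfl, Nat.cast_one,
      Int.cast_one, h.quarticChar_one]
  | prime ℓ hℓ =>
    have : Fact ℓ.Prime := ⟨hℓ⟩
    rw [quarticJacobi_prime, h.quarticChar_signedNat hn]
    rintro rfl
    exact Nat.prime_iff_prime_int.mp hℓ |>.not_isUnit (isCoprime_self.mp hp)
  | mul a b iha ihb =>
    obtain ⟨ha, hb⟩ := Nat.odd_mul.mp (Nat.odd_iff.mpr hn)
    rw [Nat.odd_iff] at ha hb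
    rw [Nat.cast_mul] at hp
    have hne {m : ℕ} (hm : m % 2 = 1) (hpm : IsCoprime (m : ℤ) p) :
        ((signedNat m : ℤ) : ZMod p) ≠ 0 := by
      refine intCast_ne_zero_of_isCoprime p (n := p) ?_ dvd_rfl
      rcases Nat.odd_mod_four_iff.mp hm with h4 | h4
      · rwa [signedNat_of_mod_four_eq_one h4]
      · rw [signedNat_of_mod_four_eq_three h4]
        exact hpm.neg_left
    have hpa := hp.of_mul_left_left
    have hpb := hp.of_mul_left_right
    rw [Nat.cast_mul, quarticJacobi_mul_left (by omega) (by omega), ← iha ha hpa, ← ihb hb hpb,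
      signedNat_mul, Int.cast_mul, h.quarticChar_mul (hne ha hpa) (hne hb hpb)]

theorem quarticChar_eq_quarticJacobi (h : IsSplitPrime p π) {n : ℤ} (hn : n % 4 = 1)
    (hp : IsCoprime n p) : quarticChar p π n = quarticJacobi n π := by
  rw [← quarticJacobi_natAbs, ← h.quarticChar_signedNat_eq_quarticJacobi (by omega) _,
    signedNat_natAbs hn]
  rw [Int.natCast_natAbs]
  exact hp.abs_left

end IsSplitPrime

/-! ### Quartic residue symbols of rational integers -/

namespace IsSplitPrime

variable {p : ℕ} [Fact p.Prime] {π : GaussianInt}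

theorem two_mul_quarticChar_two (h : IsSplitPrime p π) :
    2 * quarticChar p π 2 = 2 * ((p - 1) / 4 : ℕ) := by
  have h4 := h.mod_four
  have hI := h.isPrimitiveRoot_imagResidue
  have hsq : imagResidue p π ^ (2 * quarticChar p π 2).val = (-1) ^ ((p - 1) / 4) := by
    rw [two_mul, pow_val_add hI.pow_eq_one, h.imagResidue_pow_quarticChar h.two_ne_zero, ← pow_two,
      ← pow_mul, show (p - 1) / 4 * 2 = Fintype.card (ZMod p) / 2 by rw [ZMod.card]; omega,
      FiniteField.two_pow_card (by rw [ZMod.ringChar_zmod_n]; omega), ZMod.card,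
      ZMod.χ₈_nat_eq_if_mod_eight]
    rcases (by omega : p % 8 = 1 ∨ p % 8 = 5) with h8 | h8
    · rw [Even.neg_one_pow (Nat.even_iff.mpr (by omega)), if_neg (by omega), if_pos (Or.inl h8),
        Int.cast_one]
    · rw [Odd.neg_one_pow (Nat.odd_iff.mpr (by omega)), if_neg (by omega), if_neg (by omega),
        Int.cast_neg, Int.cast_one]
  rw [← rootLog_pow_val hI (2 * quarticChar p π 2), hsq, ← quarticChar, h.quarticChar_neg_one]

theorem exists_dvd_of_dvd_norm (hp : p % 4 = 1) {α : GaussianInt} (hα : (p : ℤ) ∣ α.norm) :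
    ∃ π, IsSplitPrime p π ∧ π ∣ α := by
  obtain ⟨π, h⟩ := exists_of_mod_four hp
  have hzero : h.reduction α * h.reduction (star α) = 0 := by
    rw [← map_mul, ← Zsqrtd.norm_eq_mul_conj, map_intCast, ZMod.intCast_zmod_eq_zero_iff_dvd]
    exact hα
  rcases mul_eq_zero.mp hzero with h0 | h0
  · exact ⟨π, h, h.reduction_eq_zero_iff.mp h0⟩
  · obtain ⟨β, hβ⟩ := h.reduction_eq_zero_iff.mp h0
    exact ⟨star π, h.star, star β, by rw [← star_star α, hβ, star_mul, mul_comm]⟩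

end IsSplitPrime

/-- `L` gives the exponents of the quartic residue symbol of rational integers modulo the odd
Gaussian integer `W`: a character modulo `W.norm`, with the values at `-1` and `2` given by the
supplementary laws, that satisfies the reciprocity law for all `n ≡ 1` modulo `4`. -/
structure IsRationalSymbol (L : ℤ → ZMod 4) (W : GaussianInt) : Prop where
  map_mul {m n : ℤ} (hm : IsCoprime m W.norm) (hn : IsCoprime n W.norm) : L (m * n) = L m + L n
  congr {m n : ℤ} (h : W.norm ∣ m - n) : L m = L n
  map_neg_one : L (-1) = 2 * ((W.norm - 1) / 4 : ℤ)
  two_mul_map_two : 2 * L 2 = 2 * ((W.norm - 1) / 4 : ℤ)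
  eq_quarticJacobi {n : ℤ} (hn : n % 4 = 1) (h : IsCoprime n W.norm) : L n = quarticJacobi n W

namespace IsRationalSymbol

variable {L M : ℤ → ZMod 4} {V W : GaussianInt}

theorem map_one (h : IsRationalSymbol L W) : L 1 = 0 := by
  have hmul := h.map_mul isCoprime_one_left isCoprime_one_left
  rwa [mul_one, left_eq_add] at hmul

theorem map_pow (h : IsRationalSymbol L W) {m : ℤ} (hm : IsCoprime m W.norm) (k : ℕ) :
    L (m ^ k) = k * L m := by
  induction k with
  | zero => rw [pow_zero, h.map_one, Nat.cast_zero, zero_mul]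
  | succ k ih => rw [pow_succ, h.map_mul hm.pow_left hm, ih]; push_cast; ring

protected theorem one : IsRationalSymbol (fun _ => 0) 1 where
  map_mul _ _ := (add_zero 0).symm
  congr _ := rfl
  map_neg_one := by decide
  two_mul_map_two := by decide
  eq_quarticJacobi hn _ := by
    rw [← Int.cast_one (R := GaussianInt),
      quarticJacobi_intCast (by omega) isCoprime_one_right]

protected theorem neg (h : IsRationalSymbol L W) : IsRationalSymbol L (-W) where
  map_mul hm hn := h.map_mul (by rwa [Zsqrtd.norm_neg] at hm) (by rwa [Zsqrtd.norm_neg] at hn)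
  congr hdvd := h.congr (by rwa [Zsqrtd.norm_neg] at hdvd)
  map_neg_one := by rw [h.map_neg_one, Zsqrtd.norm_neg]
  two_mul_map_two := by rw [h.two_mul_map_two, Zsqrtd.norm_neg]
  eq_quarticJacobi {n} hn hcop := by
    rw [Zsqrtd.norm_neg] at hcop
    rw [h.eq_quarticJacobi hn hcop, ← quarticJacobi_intCast_mul (by omega)
      isCoprime_one_right.neg_right hcop, Int.cast_neg, Int.cast_one, neg_one_mul]

protected theorem mul (hL : IsRationalSymbol L V) (hM : IsRationalSymbol M W)
    (hV : V.norm % 4 = 1) (hW : W.norm % 4 = 1) :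
    IsRationalSymbol (fun n => L n + M n) (V * W) where
  map_mul hm hn := by
    rw [Zsqrtd.norm_mul, IsCoprime.mul_right_iff] at hm hn
    rw [hL.map_mul hm.1 hn.1, hM.map_mul hm.2 hn.2]
    ring
  congr hdvd := by
    rw [Zsqrtd.norm_mul] at hdvd
    rw [hL.congr (dvd_of_mul_right_dvd hdvd), hM.congr (dvd_of_mul_left_dvd hdvd)]
  map_neg_one := by
    rw [hL.map_neg_one, hM.map_neg_one, Zsqrtd.norm_mul, intCast_mul_sub_one_div_four hV hW,
      mul_add]
  two_mul_map_two := by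
    rw [mul_add, hL.two_mul_map_two, hM.two_mul_map_two, Zsqrtd.norm_mul,
      intCast_mul_sub_one_div_four hV hW, mul_add]
  eq_quarticJacobi hn hcop := by
    rw [Zsqrtd.norm_mul, IsCoprime.mul_right_iff] at hcop
    rw [hL.eq_quarticJacobi hn hcop.1, hM.eq_quarticJacobi hn hcop.2,
      quarticJacobi_mul (by omega) hcop.1 hcop.2]

end IsRationalSymbol

theorem IsSplitPrime.isRationalSymbol {p : ℕ} [Fact p.Prime] {π : GaussianInt}
    (h : IsSplitPrime p π) : IsRationalSymbol (fun n => quarticChar p π n) π where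
  map_mul hm hn := by
    rw [h.norm_eq] at hm hn
    rw [Int.cast_mul, h.quarticChar_mul (intCast_ne_zero_of_isCoprime p hm dvd_rfl)
      (intCast_ne_zero_of_isCoprime p hn dvd_rfl)]
  congr hdvd := by
    rw [h.norm_eq, ← ZMod.intCast_zmod_eq_zero_iff_dvd, Int.cast_sub, sub_eq_zero] at hdvd
    rw [hdvd]
  map_neg_one := by
    have h4 := h.mod_four
    rw [Int.cast_neg, Int.cast_one, h.quarticChar_neg_one, h.norm_eq, ← Int.cast_natCast,
      show (((p - 1) / 4 : ℕ) : ℤ) = (p - 1) / 4 by omega]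
  two_mul_map_two := by
    have h4 := h.mod_four
    rw [Int.cast_ofNat, h.two_mul_quarticChar_two, h.norm_eq, ← Int.cast_natCast,
      show (((p - 1) / 4 : ℕ) : ℤ) = (p - 1) / 4 by omega]
  eq_quarticJacobi hn hcop := by
    rw [h.norm_eq] at hcop
    exact h.quarticChar_eq_quarticJacobi hn hcop

theorem norm_emod_four {W : GaussianInt} (hre : Odd W.re) (him : Even W.im) :
    W.norm % 4 = 1 := by
  rw [norm_eq_sq_add_sq, Int.add_emod, Int.sq_mod_four_eq_one_of_odd hre]
  obtain ⟨k, hk⟩ := him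
  rw [hk, show (k + k) ^ 2 = 4 * k ^ 2 by ring, Int.mul_emod_right]
  rfl

theorem isCoprime_re_im_of_mul {V W : GaussianInt} (h : IsCoprime (V * W).re (V * W).im) :
    IsCoprime W.re W.im := by
  obtain ⟨u, v, huv⟩ := h
  rw [Zsqrtd.re_mul, Zsqrtd.im_mul] at huv
  exact ⟨u * V.re + v * V.im, v * V.re - u * V.im, by linear_combination huv⟩

theorem mod_four_of_dvd_norm {p : ℕ} (hp : p.Prime) {W : GaussianInt} (hW : IsCoprime W.re W.im)
    (hodd : W.norm % 2 = 1) (hdvd : (p : ℤ) ∣ W.norm) : p % 4 = 1 := by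
  have hp2 : p % 2 = 1 := by exact_mod_cast emod_two_eq_one_of_dvd hdvd hodd
  have hp3 := Nat.mod_four_ne_three_of_mem_primeFactors_of_isSquare_neg_one
    (Nat.mem_primeFactors.mpr ⟨hp, Int.natCast_dvd.mp hdvd, by omega⟩)
    (ZMod.isSquare_neg_one_of_eq_sq_add_sq_of_isCoprime (norm_eq_sq_add_sq W) hW)
  omega

theorem exists_isRationalSymbol {W : GaussianInt} (hW : IsCoprime W.re W.im) (hre : Odd W.re)
    (him : Even W.im) : ∃ L, IsRationalSymbol L W := by
  induction hN : W.norm.natAbs using Nat.strong_induction_on generalizing W with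
  | _ N ih =>
  have h4 := norm_emod_four hre him
  by_cases h1 : W.norm = 1
  · rcases eq_one_or_eq_neg_one_of_norm_eq_one him h1 with rfl | rfl
    · exact ⟨_, .one⟩
    · exact ⟨_, IsRationalSymbol.one.neg⟩
  obtain ⟨p, hp, hpN⟩ := Nat.exists_prime_and_dvd (n := W.norm.natAbs) (by
    have := GaussianInt.norm_nonneg W; omega)
  have : Fact p.Prime := ⟨hp⟩
  have hpW : (p : ℤ) ∣ W.norm := Int.natCast_dvd.mpr hpN
  obtain ⟨π, hπ, V, rfl⟩ := IsSplitPrime.exists_dvd_of_dvd_norm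
    (mod_four_of_dvd_norm hp hW (by omega) hpW) hpW
  have hVim : Even V.im := by
    rw [Zsqrtd.im_mul, Int.even_add] at him
    exact (Int.even_mul.mp (him.mpr (hπ.even_im.mul_right _))).resolve_left
      (Int.not_even_iff_odd.mpr hπ.odd_re)
  have hVre : Odd V.re := by
    rw [Zsqrtd.re_mul, Int.odd_add, mul_assoc, neg_one_mul] at hre
    exact (Int.odd_mul.mp (hre.mpr (hVim.mul_left _).neg)).2
  have hlt : V.norm.natAbs < N := by
    rw [← hN, Zsqrtd.norm_mul, Int.natAbs_mul, hπ.norm_eq, Int.natAbs_natCast]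
    have := norm_emod_four hVre hVim
    exact lt_mul_of_one_lt_left (by omega) hp.one_lt
  obtain ⟨L, hL⟩ := ih _ hlt (isCoprime_re_im_of_mul hW) hVre hVim rfl
  exact ⟨_, hπ.isRationalSymbol.mul hL (norm_emod_four hπ.odd_re hπ.even_im)
    (norm_emod_four hVre hVim)⟩

/-! ### The quartic and octic residue symbols of two -/

theorem exists_eq_two_pow_mul_odd {n : ℤ} (hn : n ≠ 0) : ∃ (s : ℕ) (m : ℤ), n = 2 ^ s * m ∧
    m % 2 = 1 := by
  obtain ⟨m, hm, hodd⟩ := FiniteMultiplicity.exists_eq_pow_mul_and_not_dvd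
    (Int.finiteMultiplicity_iff.mpr ⟨(by decide : Int.natAbs 2 ≠ 1), hn⟩)
  exact ⟨_, m, hm, Int.two_dvd_ne_zero.mp hodd⟩

theorem even_or_eq_of_two_pow_mul_eq {k s : ℕ} {n m : ℤ} (h : 2 ^ k * n = 2 ^ s * m)
    (hm : m % 2 = 1) : Even n ∨ s = k := by
  rcases lt_trichotomy s k with hlt | heq | hlt
  · obtain ⟨j, rfl⟩ := Nat.exists_eq_add_of_lt hlt
    have hm' : 2 * (2 ^ j * n) = m :=
      mul_left_cancel₀ (pow_ne_zero s (two_ne_zero (α := ℤ))) (by rw [← h]; ring)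
    omega
  · exact Or.inr heq
  · obtain ⟨j, rfl⟩ := Nat.exists_eq_add_of_lt hlt
    have hn : n = 2 * (2 ^ j * m) :=
      mul_left_cancel₀ (pow_ne_zero k (two_ne_zero (α := ℤ))) (by rw [h]; ring)
    exact Or.inl (hn ▸ even_two_mul _)

theorem two_mul_intCast_eq_zero {n : ℤ} (hn : Even n) : (2 * n : ZMod 4) = 0 := by
  obtain ⟨k, rfl⟩ := hn
  push_cast
  rw [← two_mul, ← mul_assoc]
  exact zero_mul _

theorem isCoprime_re_sub_im {W : GaussianInt} (hW : IsCoprime W.re W.im) :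
    IsCoprime (W.re - W.im) W.im := by
  have hadd := hW.add_mul_left_left (-1)
  rwa [mul_neg_one, ← sub_eq_add_neg] at hadd

theorem isCoprime_re_sub_im_norm {W : GaussianInt} (hW : IsCoprime W.re W.im)
    (hodd : (W.re - W.im) % 2 = 1) : IsCoprime (W.re - W.im) W.norm := by
  rw [norm_eq_sq_add_sq,
    show W.re ^ 2 + W.im ^ 2 = 2 * W.im ^ 2 + (W.re - W.im) * (W.re + W.im) by ring]
  exact ((isCoprime_two hodd).mul_right (isCoprime_re_sub_im hW).pow_right).add_mul_left_right _

namespace IsSplitPrime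

variable {p : ℕ} [Fact p.Prime] {π : GaussianInt}

theorem four_dvd_im (h : IsSplitPrime p π) (h8 : p % 8 = 1) : 4 ∣ π.im := by
  obtain ⟨m, hm⟩ := h.odd_re
  obtain ⟨k, hk⟩ := h.even_im
  obtain ⟨u, hu⟩ := (Int.even_mul_succ_self m).two_dvd
  have hp : (p : ℤ) = 8 * u + 4 * k ^ 2 + 1 := by
    rw [h.sq_add_sq, hm, hk]
    linear_combination 4 * hu
  have hk2 : Even (k ^ 2) := Int.even_iff.mpr (by omega)
  obtain ⟨j, hj⟩ := (Int.even_pow.mp hk2).1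
  omega

theorem quarticChar_neg_one_of_mod_eight (h : IsSplitPrime p π) (h8 : p % 8 = 1) :
    quarticChar p π (-1) = 0 := by
  rw [h.quarticChar_neg_one]
  exact_mod_cast two_mul_intCast_eq_zero (n := ((p - 1) / 4 : ℕ)) (Int.even_iff.mpr (by omega))

theorem quarticChar_eq_quarticJacobi_of_mod_eight (h : IsSplitPrime p π) (h8 : p % 8 = 1) {n : ℤ}
    (hn : n % 2 = 1) (hp : IsCoprime n p) : quarticChar p π n = quarticJacobi n π := by
  rcases (by omega : n % 4 = 1 ∨ -n % 4 = 1) with h4 | h4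
  · exact h.quarticChar_eq_quarticJacobi h4 hp
  · have hneg := h.quarticChar_eq_quarticJacobi h4 hp.neg_left
    rwa [← quarticJacobi_natAbs, Int.natAbs_neg, quarticJacobi_natAbs, Int.cast_neg, ← neg_one_mul,
      h.quarticChar_mul (neg_ne_zero.mpr one_ne_zero) (intCast_ne_zero_of_isCoprime p hp dvd_rfl),
      h.quarticChar_neg_one_of_mod_eight h8, zero_add] at hneg

theorem sq_pow_eq (h : IsSplitPrime p π) (h8 : p % 8 = 1) {n : ZMod p} (hn : n ≠ 0) :
    (n ^ 2) ^ ((p - 1) / 8) = imagResidue p π ^ (quarticChar p π n).val := by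
  rw [h.imagResidue_pow_quarticChar hn, ← pow_mul]
  congr 1
  omega

theorem isCoprime_of_dvd_im (h : IsSplitPrime p π) {n : ℤ} (hn : n ∣ π.im) : IsCoprime n p := by
  obtain ⟨k, hk⟩ := hn
  have hre : IsCoprime n π.re :=
    h.isCoprime.symm.of_isCoprime_of_dvd_left (hk ▸ dvd_mul_right n k)
  rw [h.sq_add_sq, hk, mul_pow, sq n, mul_assoc]
  exact (hre.pow_right (n := 2)).add_mul_left_right _

theorem quarticChar_of_dvd_im (h : IsSplitPrime p π) (h8 : p % 8 = 1) {n : ℤ} (hn : n % 2 = 1)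
    (hdvd : n ∣ π.im) : quarticChar p π n = 0 := by
  rw [h.quarticChar_eq_quarticJacobi_of_mod_eight h8 hn (h.isCoprime_of_dvd_im hdvd),
    ← quarticJacobi_intCast hn (h.isCoprime.symm.of_isCoprime_of_dvd_left hdvd)]
  refine quarticJacobi_congr ((Zsqrtd.intCast_dvd _ _).mpr ⟨?_, ?_⟩)
  · rw [Zsqrtd.re_sub, Zsqrtd.re_intCast, sub_self]
    exact dvd_zero n
  · rwa [Zsqrtd.im_sub, Zsqrtd.im_intCast, sub_zero]

theorem re_sub_im_eq (h : IsSplitPrime p π) :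
    (π.re - π.im : ZMod p) = -(π.im : ZMod p) * (1 + imagResidue p π) := by
  linear_combination h.re_add_im_mul_imagResidue

theorem quarticChar_re_sub_im (h : IsSplitPrime p π) (h8 : p % 8 = 1) (hre : π.re % 4 = 1) :
    quarticChar p π (π.re - π.im) = ((π.re - π.im - 1) / 4 : ℤ) := by
  have him := h.four_dvd_im h8
  have hp := isCoprime_re_sub_im_norm h.isCoprime (by omega)
  rw [h.norm_eq] at hp
  rw [← Int.cast_sub, h.quarticChar_eq_quarticJacobi (by omega) hp,
    ← quarticJacobi_one_add_I (by omega), ← quarticJacobi_intCast_mul (by omega)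
    (isCoprime_re_sub_im h.isCoprime) (isCoprime_norm_one_add_I (by omega))]
  refine quarticJacobi_congr ((Zsqrtd.intCast_dvd _ _).mpr ⟨⟨1, ?_⟩, ⟨0, ?_⟩⟩)
  · simp only [Zsqrtd.re_sub, Zsqrtd.re_mul, Zsqrtd.re_intCast, Zsqrtd.im_intCast]
    ring
  · simp only [Zsqrtd.im_sub, Zsqrtd.im_mul, Zsqrtd.re_intCast, Zsqrtd.im_intCast]
    ring

theorem two_pow_eq_sub_quarticChar_im (h : IsSplitPrime p π) (h8 : p % 8 = 1)
    (hre : π.re % 4 = 1) :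
    (2 : ZMod p) ^ ((p - 1) / 8) = imagResidue p π ^
      (2 * ((π.re - 1) / 4 : ℤ) + (π.im / 4 : ℤ) - quarticChar p π π.im : ZMod 4).val := by
  have hζ := h.isPrimitiveRoot_imagResidue.pow_eq_one
  have hζ0 := h.isPrimitiveRoot_imagResidue.ne_zero four_ne_zero
  have him := h.four_dvd_im h8
  have hne : (π.re - π.im : ZMod p) ≠ 0 := mod_cast intCast_ne_zero_of_isCoprime p
    (isCoprime_re_sub_im_norm h.isCoprime (by omega)) h.norm_eq.symm.dvd
  have hsq : (2 : ZMod p) * π.im ^ 2 = imagResidue p π ^ 3 * (π.re - π.im) ^ 2 := by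
    rw [h.re_sub_im_eq]
    linear_combination (-(π.im : ZMod p) ^ 2 *
      (imagResidue p π ^ 3 + 2 * imagResidue p π ^ 2 - 2)) * h.imagResidue_sq
  have hpow := congrArg (· ^ ((p - 1) / 8)) hsq
  simp only [mul_pow _ _ ((p - 1) / 8)] at hpow
  rw [h.sq_pow_eq h8 h.im_ne_zero, h.sq_pow_eq h8 hne, ← pow_mul,
    ← pow_val_natCast hζ (3 * _), ← pow_val_add hζ, h.quarticChar_re_sub_im h8 hre] at hpow
  refine mul_right_cancel₀ (pow_ne_zero _ hζ0) (hpow.trans ?_)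
  rw [← pow_val_add hζ, sub_add_cancel]
  congr 2
  obtain ⟨C, hC⟩ : ∃ C, π.re = 4 * C + 1 := ⟨π.re / 4, by omega⟩
  obtain ⟨D, hD⟩ := him
  have hm : (((p - 1) / 8 : ℕ) : ℤ) = 2 * C ^ 2 + C + 2 * D ^ 2 := by
    have hp : (p : ℤ) = 8 * (2 * C ^ 2 + C + 2 * D ^ 2) + 1 := by rw [h.sq_add_sq, hC, hD]; ring
    omega
  rw [show (π.re - π.im - 1) / 4 = C - D by omega, show (π.re - 1) / 4 = C by omega,
    show π.im / 4 = D by omega, Nat.cast_mul, ← Int.cast_natCast ((p - 1) / 8), hm]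
  push_cast
  generalize (C : ZMod 4) = C
  generalize (D : ZMod 4) = D
  decide +revert

theorem quarticChar_two_eq_sub (h : IsSplitPrime p π) (h8 : p % 8 = 1) (hre : π.re % 4 = 1) :
    quarticChar p π 2 = 2 * (π.im / 4 : ℤ) - 2 * quarticChar p π π.im := by
  have hζ := h.isPrimitiveRoot_imagResidue
  have hsq := h.sq_pow_eq h8 h.two_ne_zero
  rw [← pow_mul, mul_comm, pow_mul, h.two_pow_eq_sub_quarticChar_im h8 hre, sq,
    ← pow_val_add hζ.pow_eq_one] at hsq
  rw [← rootLog_pow_val hζ (quarticChar p π 2), ← hsq, rootLog_pow_val hζ]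
  generalize (((π.re - 1) / 4 : ℤ) : ZMod 4) = C
  generalize ((π.im / 4 : ℤ) : ZMod 4) = D
  generalize quarticChar p π π.im = χ
  decide +revert

theorem exists_quarticChar_im_eq_mul (h : IsSplitPrime p π) (h8 : p % 8 = 1) :
    ∃ s : ℕ, Even (s * (π.im / 4)) ∧ quarticChar p π π.im = s * quarticChar p π 2 := by
  have him0 : π.im ≠ 0 := fun h0 => h.im_ne_zero (by rw [h0, Int.cast_zero])
  obtain ⟨D, hD⟩ := h.four_dvd_im h8
  obtain ⟨s, m, hsm, hm⟩ := exists_eq_two_pow_mul_odd him0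
  refine ⟨s, ?_, ?_⟩
  · rw [show π.im / 4 = D by omega]
    rcases even_or_eq_of_two_pow_mul_eq (k := 2) (hD.symm.trans hsm) hm with hD2 | rfl
    · exact hD2.mul_left _
    · exact even_two.mul_right _
  · have hmdvd : m ∣ π.im := hsm ▸ dvd_mul_left m _
    have hm0 := intCast_ne_zero_of_isCoprime (R := ZMod p) p (h.isCoprime_of_dvd_im hmdvd) dvd_rfl
    have hpow := h.isRationalSymbol.map_pow (m := 2)
      (by rw [h.norm_eq, isCoprime_comm]; exact isCoprime_two (by omega)) s
    rw [hsm, Int.cast_mul, h.quarticChar_mul (by exact_mod_cast pow_ne_zero s h.two_ne_zero) hm0,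
      h.quarticChar_of_dvd_im h8 hm hmdvd, add_zero, hpow, Int.cast_ofNat]

theorem quarticChar_im (h : IsSplitPrime p π) (h8 : p % 8 = 1) (hre : π.re % 4 = 1) :
    quarticChar p π π.im = 0 := by
  obtain ⟨s, heven, hs⟩ := h.exists_quarticChar_im_eq_mul h8
  have hsD := two_mul_intCast_eq_zero heven
  have h2 := h.quarticChar_two_eq_sub h8 hre
  push_cast at hsD
  rw [h2] at hs
  have h4 : (4 : ZMod 4) = 0 := rfl
  linear_combination (1 - 2 * (s : ZMod 4)) * (hs + hsD) +
    (s ^ 2 : ZMod 4) * quarticChar p π π.im * h4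

theorem quarticChar_two (h : IsSplitPrime p π) (h8 : p % 8 = 1) (hre : π.re % 4 = 1) :
    quarticChar p π 2 = 2 * (π.im / 4 : ℤ) := by
  rw [h.quarticChar_two_eq_sub h8 hre, h.quarticChar_im h8 hre, mul_zero, sub_zero]

theorem two_pow_eq (h : IsSplitPrime p π) (h8 : p % 8 = 1) (hre : π.re % 4 = 1) :
    (2 : ZMod p) ^ ((p - 1) / 8) =
      imagResidue p π ^ (2 * ((π.re - 1) / 4 : ℤ) + (π.im / 4 : ℤ) : ZMod 4).val := by
  rw [h.two_pow_eq_sub_quarticChar_im h8 hre, h.quarticChar_im h8 hre, sub_zero]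

end IsSplitPrime

/-! ### Descent along a double representation -/

theorem quarticJacobi_eq_of_mul_eq_sq {z g y : ℤ} {α β γ : GaussianInt} (hy : y ≠ 0)
    (h : z * g = y ^ 2)
    (hprime : ∀ ℓ : ℕ, ℓ.Prime → (ℓ : ℤ) ∣ y →
      (¬ (ℓ : ℤ) ∣ g ∧ 2 * quarticJacobi ℓ α = quarticJacobi ℓ β) ∨
      (quarticJacobi ℓ β = 2 * quarticJacobi ℓ γ ∧
        (¬ (ℓ : ℤ) ∣ z ∨ quarticJacobi ℓ α = -quarticJacobi ℓ γ))) :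
    quarticJacobi z α = quarticJacobi y β + quarticJacobi g γ := by
  have hz0 : z ≠ 0 := left_ne_zero_of_mul (h ▸ pow_ne_zero 2 hy)
  have hg0 : g ≠ 0 := right_ne_zero_of_mul (h ▸ pow_ne_zero 2 hy)
  have hsupp {n : ℤ} (hn : n ∣ y ^ 2) : n.natAbs.primeFactors ⊆ y.natAbs.primeFactors := by
    rw [← Nat.primeFactors_pow y.natAbs two_ne_zero, ← Int.natAbs_pow]
    exact Nat.primeFactors_mono (Int.natAbs_dvd_natAbs.mpr hn)
      (Int.natAbs_ne_zero.mpr (pow_ne_zero 2 hy))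
  rw [quarticJacobi_eq_sum (n := y) subset_rfl, quarticJacobi_eq_sum (hsupp (Dvd.intro g h)),
    quarticJacobi_eq_sum (hsupp (Dvd.intro_left z h)), ← Finset.sum_add_distrib]
  refine Finset.sum_congr rfl fun ℓ hℓ => ?_
  have hval : (z.natAbs.factorization ℓ : ZMod 4) + g.natAbs.factorization ℓ =
      2 * y.natAbs.factorization ℓ := by
    rw [← Nat.cast_add, ← Finsupp.add_apply, ← Nat.factorization_mul (Int.natAbs_ne_zero.mpr hz0)
      (Int.natAbs_ne_zero.mpr hg0), ← Int.natAbs_mul, h, Int.natAbs_pow, Nat.factorization_pow,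
      Finsupp.smul_apply, smul_eq_mul, Nat.cast_mul, Nat.cast_two]
  have hzero {n : ℤ} (hn : ¬ (ℓ : ℤ) ∣ n) : n.natAbs.factorization ℓ = 0 :=
    Nat.factorization_eq_zero_of_not_dvd fun hdvd => hn (Int.natCast_dvd.mpr hdvd)
  have h4 : (4 : ZMod 4) = 0 := rfl
  rcases hprime ℓ (Nat.prime_of_mem_primeFactors hℓ)
    (Int.natCast_dvd.mpr (Nat.dvd_of_mem_primeFactors hℓ)) with
    ⟨hg, hα⟩ | ⟨hβ, hz | hα⟩
  · rw [hzero hg, Nat.cast_zero] at hval ⊢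
    rw [← hα]
    linear_combination quarticJacobi ℓ α * hval
  · rw [hzero hz, Nat.cast_zero] at hval ⊢
    rw [hβ]
    linear_combination (-quarticJacobi ℓ γ) * hval -
      quarticJacobi ℓ γ * y.natAbs.factorization ℓ * h4
  · rw [hβ, hα]
    linear_combination (-quarticJacobi ℓ γ) * hval -
      quarticJacobi ℓ γ * y.natAbs.factorization ℓ * h4

theorem quarticJacobi_one_add_I_mul_eq_zero {n : ℤ} {W : GaussianInt} (hn : n % 2 = 1)
    (hdvd : n ∣ W.re + W.im) (hW : IsCoprime n W.norm) : quarticJacobi n (⟨1, 1⟩ * W) = 0 := by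
  have hsq : IsCoprime n ((W.re - W.im) ^ 2) := by
    obtain ⟨k, hk⟩ := hdvd
    rw [show (W.re - W.im) ^ 2 = 2 * W.norm + n * (-(k * (W.re + W.im))) by
      rw [norm_eq_sq_add_sq]; linear_combination (-W.re - W.im) * hk]
    exact ((isCoprime_two hn).mul_right hW).add_mul_left_right _
  rw [← quarticJacobi_intCast hn ((IsCoprime.pow_right_iff two_pos).mp hsq)]
  refine quarticJacobi_congr ((Zsqrtd.intCast_dvd _ _).mpr ⟨⟨0, ?_⟩, ?_⟩)
  · simp only [Zsqrtd.re_sub, Zsqrtd.re_mul, Zsqrtd.re_intCast]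
    ring
  · simpa only [Zsqrtd.im_sub, Zsqrtd.im_mul, Zsqrtd.im_intCast, one_mul, sub_zero, add_comm]

theorem quarticJacobi_intCast_mul_one_add_I_mul {n g : ℤ} {W : GaussianInt} (hn : n % 4 = 1)
    (hg : IsCoprime n g) (hW : IsCoprime n W.norm) :
    quarticJacobi n (g * (⟨1, 1⟩ * W)) = quarticJacobi n W + ((n - 1) / 4 : ℤ) := by
  have hI := isCoprime_norm_one_add_I (n := n) (by omega)
  rw [quarticJacobi_intCast_mul (by omega) hg (by rw [Zsqrtd.norm_mul]; exact hI.mul_right hW),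
    quarticJacobi_mul (by omega) hI hW, quarticJacobi_one_add_I hn, add_comm]

theorem exists_eq_intCast_mul_one_add_I_mul {c e : ℤ} (hc : c % 4 = 1) (he : e % 4 = 1) :
    ∃ (g : ℤ) (W : GaussianInt), (⟨c, e⟩ : GaussianInt) = g * (⟨1, 1⟩ * W) ∧ g % 4 = 1 ∧
      IsCoprime W.re W.im := by
  obtain ⟨g, u, v, hg4, rfl, rfl, huv⟩ : ∃ g u v : ℤ, g % 4 = 1 ∧ c = g * u ∧ e = g * v ∧
      IsCoprime u v := by
    obtain ⟨u, v, hu, hv, huv⟩ := extract_gcd c e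
    rw [gcd_isUnit_iff] at huv
    have hodd := emod_two_eq_one_of_dvd (gcd_dvd_left c e) (by omega)
    rcases (by omega : gcd c e % 4 = 1 ∨ -gcd c e % 4 = 1) with h4 | h4
    · exact ⟨_, u, v, h4, hu, hv, huv⟩
    · exact ⟨_, -u, -v, h4, by rwa [neg_mul_neg], by rwa [neg_mul_neg], huv.neg_neg⟩
  have hmod (t : ℤ) : g * t % 4 = t % 4 := by rw [Int.mul_emod, hg4, one_mul, Int.emod_emod]
  rw [hmod] at hc he
  obtain ⟨a, ha⟩ : ∃ a, u + v = 2 * a := ⟨(u + v) / 2, by omega⟩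
  obtain ⟨b, hb⟩ : ∃ b, v - u = 2 * b := ⟨(v - u) / 2, by omega⟩
  obtain rfl : u = a - b := by omega
  obtain rfl : v = a + b := by omega
  obtain ⟨k, l, hkl⟩ := huv
  refine ⟨g, ⟨a, b⟩, ?_, hg4, k + l, l - k, by linear_combination hkl⟩
  refine Zsqrtd.ext ?_ ?_ <;>
  simp only [Zsqrtd.re_mul, Zsqrtd.im_mul, Zsqrtd.re_intCast, Zsqrtd.im_intCast] <;>
  ring

/-- The prime `p ≡ 1` modulo `8` is represented as `c² + d²` with `c ≡ 1` modulo `4` and as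
`x² + 2qy²`, where `q ≡ 1` modulo `4` is coprime to `x`. -/
structure IsDoubleRep (p : ℕ) (q c d x y : ℤ) : Prop where
  eq_sq_add_sq : (p : ℤ) = c ^ 2 + d ^ 2
  eq_sq_add_mul_sq : (p : ℤ) = x ^ 2 + 2 * q * y ^ 2
  p_mod_eight : p % 8 = 1
  c_mod_four : c % 4 = 1
  q_mod_four : q % 4 = 1
  isCoprime_x_q : IsCoprime x q

namespace IsDoubleRep

variable {p : ℕ} {q c d x y : ℤ}

theorem neg_x (h : IsDoubleRep p q c d x y) : IsDoubleRep p q c d (-x) y :=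
  { h with
    eq_sq_add_mul_sq := by rw [h.eq_sq_add_mul_sq]; ring
    isCoprime_x_q := h.isCoprime_x_q.neg_left }

theorem neg_d (h : IsDoubleRep p q c d x y) : IsDoubleRep p q c (-d) x y :=
  { h with eq_sq_add_sq := by rw [h.eq_sq_add_sq, neg_sq] }

theorem isSplitPrime (h : IsDoubleRep p q c d x y) : IsSplitPrime p ⟨c, d⟩ where
  norm_eq := by rw [norm_eq_sq_add_sq, h.eq_sq_add_sq]
  even_im := by
    have hp := h.eq_sq_add_sq
    have hc := h.c_mod_four
    have h8 := h.p_mod_eight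
    obtain ⟨k, hk⟩ : Odd (c ^ 2) := (Int.odd_iff.mpr (by omega)).pow
    exact (Int.even_pow.mp (Int.even_iff.mpr (by omega : d ^ 2 % 2 = 0))).1

theorem x_odd (h : IsDoubleRep p q c d x y) : x % 2 = 1 := by
  have hp := h.eq_sq_add_mul_sq
  have h8 := h.p_mod_eight
  rw [mul_assoc] at hp
  have hx2 : Odd (x ^ 2) := Int.odd_iff.mpr (by omega)
  exact Int.odd_iff.mp (Int.odd_pow.mp hx2 |>.resolve_right two_ne_zero)

theorem two_dvd_y (h : IsDoubleRep p q c d x y) : 2 ∣ y := by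
  have hp := h.eq_sq_add_mul_sq
  have h8 := h.p_mod_eight
  have hq := h.q_mod_four
  have hx8 := Int.sq_mod_four_eq_one_of_odd (Int.odd_iff.mpr h.x_odd)
  by_contra hy
  have hy4 := Int.sq_mod_four_eq_one_of_odd (Int.not_even_iff_odd.mp fun he => hy he.two_dvd)
  have hqy : q * y ^ 2 % 4 = 1 := by rw [Int.mul_emod, hq, hy4]; rfl
  rw [mul_assoc] at hp
  omega

theorem isCoprime_x_y [hp : Fact p.Prime] (h : IsDoubleRep p q c d x y) : IsCoprime x y :=
  isCoprime_of_sq_add_mul_sq_eq_prime hp.out h.eq_sq_add_mul_sq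

theorem isCoprime_x_p [Fact p.Prime] (h : IsDoubleRep p q c d x y) : IsCoprime x p := by
  rw [h.eq_sq_add_mul_sq, add_comm, sq x]
  exact (((isCoprime_two h.x_odd).mul_right h.isCoprime_x_q).mul_right
    h.isCoprime_x_y.pow_right).add_mul_left_right x

theorem isCoprime_y_p [Fact p.Prime] (h : IsDoubleRep p q c d x y) : IsCoprime y p := by
  rw [h.eq_sq_add_mul_sq, show x ^ 2 + 2 * q * y ^ 2 = x ^ 2 + y * (2 * q * y) by ring]
  exact (h.isCoprime_x_y.symm.pow_right (n := 2)).add_mul_left_right _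

theorem y_ne_zero [Fact p.Prime] (h : IsDoubleRep p q c d x y) : y ≠ 0 := by
  have hp := (Fact.out : p.Prime).one_lt
  rintro rfl
  have hy := Int.isCoprime_iff_gcd_eq_one.mp h.isCoprime_y_p
  rw [Int.gcd_zero_left, Int.natAbs_natCast] at hy
  omega

end IsDoubleRep

/-- A descent for the double representation `(c, d, x, y)` with `x ≡ 1` modulo `4`. The Gaussian
integer `c + (x + d)i` is factored as `g(1 + i)W` with `g ≡ 1` modulo `4` and `W` primitive, and
`y = 2 ^ s * y₀` with `y₀` odd; then `g` divides `y₀ ^ 2`, with quotient `z`. -/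
structure IsDescent (p : ℕ) (q c d x y g z y₀ : ℤ) (s : ℕ) (W : GaussianInt) : Prop extends
    IsDoubleRep p q c d x y where
  x_mod_four : x % 4 = 1
  isCoprime_q : IsCoprime q (x + d)
  mk_eq : (⟨c, x + d⟩ : GaussianInt) = g * (⟨1, 1⟩ * W)
  g_mod_four : g % 4 = 1
  isCoprime_re_im : IsCoprime W.re W.im
  y_eq : y = 2 ^ s * y₀
  y₀_odd : y₀ % 2 = 1
  z_mul_g : z * g = y₀ ^ 2

theorem IsDoubleRep.exists_isDescent {p : ℕ} [Fact p.Prime] {q c d x y : ℤ}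
    (h : IsDoubleRep p q c d x y) (hx : x % 4 = 1) (hq : IsCoprime q (x + d)) :
    ∃ g z y₀ s W, IsDescent p q c d x y g z y₀ s W := by
  have hd : 4 ∣ d := h.isSplitPrime.four_dvd_im h.p_mod_eight
  obtain ⟨g, W, hgW, hg, hW⟩ := exists_eq_intCast_mul_one_add_I_mul h.c_mod_four
    (by omega : (x + d) % 4 = 1)
  obtain ⟨s, y₀, hy, hy₀⟩ := exists_eq_two_pow_mul_odd h.y_ne_zero
  obtain ⟨⟨f, hf⟩, e, he⟩ := (Zsqrtd.intCast_dvd _ _).mp (Dvd.intro _ hgW.symm)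
  have hg2 : IsCoprime g 2 := isCoprime_two (by omega)
  have hgq : IsCoprime g q := hq.symm.of_isCoprime_of_dvd_left (Dvd.intro e he.symm)
  have hdvd : g ∣ 2 * (q * ((2 ^ s) ^ 2 * y₀ ^ 2)) := by
    refine ⟨g * f ^ 2 + g * e ^ 2 - 2 * x * e, ?_⟩
    have hp := h.eq_sq_add_sq.symm.trans h.eq_sq_add_mul_sq
    dsimp only at hf he
    rw [hy, mul_pow] at hp
    linear_combination (x + d + g * e - 2 * x) * he + (c + g * f) * hf - hp
  obtain ⟨z, hz⟩ := hg2.pow_right.pow_right.dvd_of_dvd_mul_left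
    (hgq.dvd_of_dvd_mul_left (hg2.dvd_of_dvd_mul_left hdvd))
  exact ⟨g, z, y₀, s, W, h, hx, hq, hgW, hg, hW, hy, hy₀, by rw [hz, mul_comm]⟩

namespace IsDescent

variable {p : ℕ} {q c d x y g z y₀ : ℤ} {s : ℕ} {W : GaussianInt}

theorem c_eq (h : IsDescent p q c d x y g z y₀ s W) : c = g * (W.re - W.im) := by
  have hre := congrArg Zsqrtd.re h.mk_eq
  simp only [Zsqrtd.re_mul, Zsqrtd.re_intCast, Zsqrtd.im_intCast] at hre
  linear_combination hre

theorem x_add_d_eq (h : IsDescent p q c d x y g z y₀ s W) : x + d = g * (W.re + W.im) := by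
  have him := congrArg Zsqrtd.im h.mk_eq
  simp only [Zsqrtd.im_mul, Zsqrtd.re_intCast, Zsqrtd.im_intCast] at him
  linear_combination him

theorem mod_four_of_g_mul (h : IsDescent p q c d x y g z y₀ s W) {n : ℤ} (hn : g * n % 4 = 1) :
    n % 4 = 1 := by
  rwa [Int.mul_emod, h.g_mod_four, one_mul, Int.emod_emod] at hn

theorem re_sub_im_mod_four (h : IsDescent p q c d x y g z y₀ s W) : (W.re - W.im) % 4 = 1 :=
  h.mod_four_of_g_mul (h.c_eq ▸ h.c_mod_four)

theorem z_mod_four (h : IsDescent p q c d x y g z y₀ s W) : z % 4 = 1 := by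
  refine h.mod_four_of_g_mul ?_
  rw [mul_comm, h.z_mul_g]
  exact Int.sq_mod_four_eq_one_of_odd (Int.odd_iff.mpr h.y₀_odd)

theorem g_mul_norm (h : IsDescent p q c d x y g z y₀ s W) :
    g * W.norm = x * (W.re + W.im) + q * (2 ^ (2 * s) * z) := by
  have hg := h.g_mod_four
  refine mul_left_cancel₀ (mul_ne_zero two_ne_zero (by omega : g ≠ 0)) ?_
  have hp := h.eq_sq_add_sq.symm.trans h.eq_sq_add_mul_sq
  rw [h.y_eq] at hp
  rw [norm_eq_sq_add_sq]
  linear_combination -(c + g * (W.re - W.im)) * h.c_eq -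
    (d - x + g * (W.re + W.im)) * h.x_add_d_eq + hp - 2 * q * 2 ^ (2 * s) * h.z_mul_g

variable [Fact p.Prime]

theorem re_add_im_mod_four (h : IsDescent p q c d x y g z y₀ s W) : (W.re + W.im) % 4 = 1 := by
  have hd : 4 ∣ d := h.isSplitPrime.four_dvd_im h.p_mod_eight
  have hx := h.x_mod_four
  exact h.mod_four_of_g_mul (h.x_add_d_eq ▸ (by omega : (x + d) % 4 = 1))

theorem even_im (h : IsDescent p q c d x y g z y₀ s W) : Even W.im := by
  have hadd := h.re_add_im_mod_four
  have hsub := h.re_sub_im_mod_four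
  exact Int.even_iff.mpr (by omega)

theorem odd_re (h : IsDescent p q c d x y g z y₀ s W) : Odd W.re := by
  have hadd := h.re_add_im_mod_four
  have hsub := h.re_sub_im_mod_four
  exact Int.odd_iff.mpr (by omega)

theorem isCoprime_y₀_x (h : IsDescent p q c d x y g z y₀ s W) : IsCoprime y₀ x :=
  h.isCoprime_x_y.symm.of_isCoprime_of_dvd_left (Dvd.intro_left _ h.y_eq.symm)

theorem isCoprime_z_x (h : IsDescent p q c d x y g z y₀ s W) : IsCoprime z x :=
  (h.isCoprime_y₀_x.pow_left (m := 2)).of_isCoprime_of_dvd_left (Dvd.intro _ h.z_mul_g)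

theorem isCoprime_g_x (h : IsDescent p q c d x y g z y₀ s W) : IsCoprime g x :=
  (h.isCoprime_y₀_x.pow_left (m := 2)).of_isCoprime_of_dvd_left (Dvd.intro_left _ h.z_mul_g)

theorem isCoprime_x_norm (h : IsDescent p q c d x y g z y₀ s W) : IsCoprime x W.norm := by
  refine IsCoprime.of_mul_right_right (y := g) ?_
  rw [h.g_mul_norm, add_comm]
  exact (h.isCoprime_x_q.mul_right ((isCoprime_two h.x_odd).pow_right.mul_right
    h.isCoprime_z_x.symm)).add_mul_left_right _

theorem isCoprime_re_add_im_norm (h : IsDescent p q c d x y g z y₀ s W) :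
    IsCoprime (W.re + W.im) W.norm := by
  have hadd := h.re_add_im_mod_four
  have hW := isCoprime_re_sub_im_norm (W := star W) h.isCoprime_re_im.neg_right
    (by simpa using (by omega : (W.re + W.im) % 2 = 1))
  simpa [Zsqrtd.norm_conj] using hW

theorem isCoprime_mul_norm (h : IsDescent p q c d x y g z y₀ s W) :
    IsCoprime (q * (2 ^ (2 * s) * z)) W.norm := by
  rw [show q * (2 ^ (2 * s) * z) = -(x * (W.re + W.im)) + W.norm * g by
    linear_combination -h.g_mul_norm]
  exact (h.isCoprime_x_norm.mul_left h.isCoprime_re_add_im_norm).neg_left.add_mul_left_left g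

theorem isCoprime_q_norm (h : IsDescent p q c d x y g z y₀ s W) : IsCoprime q W.norm :=
  h.isCoprime_mul_norm.of_mul_left_left

theorem isCoprime_z_norm (h : IsDescent p q c d x y g z y₀ s W) : IsCoprime z W.norm :=
  h.isCoprime_mul_norm.of_mul_left_right.of_mul_left_right

theorem isCoprime_two_norm (h : IsDescent p q c d x y g z y₀ s W) : IsCoprime 2 W.norm := by
  have hN := norm_emod_four h.odd_re h.even_im
  exact (isCoprime_two (by omega)).symm

theorem quarticJacobi_add_x (h : IsDescent p q c d x y g z y₀ s W) :
    quarticJacobi x W + ((x - 1) / 4 : ℤ) = quarticChar p ⟨c, d⟩ x := by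
  rw [← quarticJacobi_intCast_mul_one_add_I_mul h.x_mod_four h.isCoprime_g_x.symm
    h.isCoprime_x_norm, ← h.mk_eq, h.isSplitPrime.quarticChar_eq_quarticJacobi_of_mod_eight
    h.p_mod_eight h.x_odd h.isCoprime_x_p]
  refine quarticJacobi_congr ((Zsqrtd.intCast_dvd _ _).mpr ⟨⟨0, ?_⟩, ⟨1, ?_⟩⟩)
  · rw [Zsqrtd.re_sub]
    ring
  · rw [Zsqrtd.im_sub]
    ring

theorem quarticJacobi_re_add_im (h : IsDescent p q c d x y g z y₀ s W) :
    quarticJacobi (W.re + W.im) W + ((W.re + W.im - 1) / 4 : ℤ) = 0 := by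
  have hadd := h.re_add_im_mod_four
  rw [← quarticJacobi_one_add_I hadd, add_comm, ← quarticJacobi_mul (by omega)
    (isCoprime_norm_one_add_I (by omega)) h.isCoprime_re_add_im_norm]
  exact quarticJacobi_one_add_I_mul_eq_zero (by omega) dvd_rfl h.isCoprime_re_add_im_norm

theorem quarticJacobi_add_q (h : IsDescent p q c d x y g z y₀ s W) :
    quarticJacobi q W + ((q - 1) / 4 : ℤ) = quarticJacobi q ⟨c, x + d⟩ := by
  rw [h.mk_eq, quarticJacobi_intCast_mul_one_add_I_mul h.q_mod_four
    (h.isCoprime_q.of_isCoprime_of_dvd_right (Dvd.intro _ h.x_add_d_eq.symm)) h.isCoprime_q_norm]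

theorem two_mul_quarticJacobi_of_prime (h : IsDescent p q c d x y g z y₀ s W) {ℓ : ℕ}
    (hℓ : ℓ.Prime) (hy : (ℓ : ℤ) ∣ y₀) (hg : ¬ (ℓ : ℤ) ∣ g) :
    2 * quarticJacobi ℓ W = quarticJacobi ℓ ⟨c, d⟩ := by
  have hz := ((Nat.prime_iff_prime_int.mp hℓ).dvd_or_dvd
    (h.z_mul_g ▸ hy.trans (dvd_pow_self y₀ two_ne_zero))).resolve_right hg
  have hodd := emod_two_eq_one_of_dvd hy h.y₀_odd
  have hI := isCoprime_norm_one_add_I hodd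
  have hW := h.isCoprime_z_norm.of_isCoprime_of_dvd_left hz
  have hIW : IsCoprime (ℓ : ℤ) ((⟨1, 1⟩ : GaussianInt) * W).norm := by
    rw [Zsqrtd.norm_mul]
    exact hI.mul_right hW
  have hgℓ : IsCoprime (ℓ : ℤ) g := (Nat.prime_iff_prime_int.mp hℓ).coprime_iff_not_dvd.mpr hg
  have hdvd : (ℓ : ℤ) ∣ c ^ 2 + d ^ 2 - x ^ 2 := by
    rw [← h.eq_sq_add_sq, h.eq_sq_add_mul_sq, add_sub_cancel_left, h.y_eq]
    exact Dvd.dvd.mul_left ((hy.mul_left _).trans (dvd_pow_self _ two_ne_zero)) _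
  have hnorm : IsCoprime (ℓ : ℤ) (⟨c, x + d⟩ : GaussianInt).norm := by
    rw [h.mk_eq, Zsqrtd.norm_mul, Zsqrtd.norm_intCast]
    exact (hgℓ.mul_right hgℓ).mul_right hIW
  have hcircle := two_mul_quarticJacobi_of_dvd hodd hdvd
    (h.isCoprime_y₀_x.of_isCoprime_of_dvd_left hy) hnorm
  rw [h.mk_eq, quarticJacobi_intCast_mul hodd hgℓ hIW, quarticJacobi_mul hodd hI hW,
    quarticJacobi_I hodd] at hcircle
  linear_combination hcircle

theorem quarticJacobi_mk_of_dvd_g (h : IsDescent p q c d x y g z y₀ s W) {ℓ : ℕ}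
    (hy : (ℓ : ℤ) ∣ y₀) (hg : (ℓ : ℤ) ∣ g) :
    quarticJacobi ℓ ⟨c, d⟩ = 2 * quarticJacobi ℓ ⟨1, 1⟩ := by
  have hodd := emod_two_eq_one_of_dvd hy h.y₀_odd
  rw [← quarticJacobi_I hodd, ← quarticJacobi_intCast_mul hodd
    (h.isCoprime_y₀_x.of_isCoprime_of_dvd_left hy).neg_right (isCoprime_norm_I _)]
  refine quarticJacobi_congr ((Zsqrtd.intCast_dvd _ _).mpr ⟨?_, ?_⟩)
  · simpa using hg.trans (Dvd.intro _ h.c_eq.symm)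
  · simpa [add_comm] using hg.trans (Dvd.intro _ h.x_add_d_eq.symm)

theorem quarticJacobi_of_dvd_z_of_dvd_g (h : IsDescent p q c d x y g z y₀ s W) {ℓ : ℕ}
    (hy : (ℓ : ℤ) ∣ y₀) (hg : (ℓ : ℤ) ∣ g) (hz : (ℓ : ℤ) ∣ z) :
    quarticJacobi ℓ W = -quarticJacobi ℓ ⟨1, 1⟩ := by
  have hodd := emod_two_eq_one_of_dvd hy h.y₀_odd
  have hW := h.isCoprime_z_norm.of_isCoprime_of_dvd_left hz
  have hxe : (ℓ : ℤ) ∣ x * (W.re + W.im) := by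
    rw [show x * (W.re + W.im) = g * W.norm - q * (2 ^ (2 * s) * z) by
      linear_combination -h.g_mul_norm]
    exact dvd_sub (hg.mul_right _) ((hz.mul_left _).mul_left _)
  have he := (h.isCoprime_y₀_x.of_isCoprime_of_dvd_left hy).dvd_of_dvd_mul_left hxe
  have hprod := quarticJacobi_one_add_I_mul_eq_zero hodd he hW
  rw [quarticJacobi_mul hodd (isCoprime_norm_one_add_I hodd) hW] at hprod
  exact eq_neg_of_add_eq_zero_right hprod

theorem quarticJacobi_z (h : IsDescent p q c d x y g z y₀ s W) :
    quarticJacobi z W = quarticChar p ⟨c, d⟩ y₀ + ((g - 1) / 4 : ℤ) := by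
  have hy₀p := h.isCoprime_y_p.of_isCoprime_of_dvd_left (Dvd.intro_left _ h.y_eq.symm)
  have hy₀ := h.y₀_odd
  rw [h.isSplitPrime.quarticChar_eq_quarticJacobi_of_mod_eight h.p_mod_eight hy₀ hy₀p,
    ← quarticJacobi_one_add_I h.g_mod_four]
  refine quarticJacobi_eq_of_mul_eq_sq (by omega) h.z_mul_g fun ℓ hℓ hy => ?_
  by_cases hg : (ℓ : ℤ) ∣ g
  · refine Or.inr ⟨h.quarticJacobi_mk_of_dvd_g hy hg, ?_⟩
    exact or_iff_not_imp_left.mpr fun hz =>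
      h.quarticJacobi_of_dvd_z_of_dvd_g hy hg (not_not.mp hz)
  · exact Or.inl ⟨hg, h.two_mul_quarticJacobi_of_prime hℓ hy hg⟩

theorem intCast_norm_sub_one_div_four (h : IsDescent p q c d x y g z y₀ s W) :
    (2 * ((W.norm - 1) / 4 : ℤ) : ZMod 4) = 2 * ((x + d - c) / 4 : ℤ) := by
  obtain ⟨k, hk⟩ := h.odd_re
  obtain ⟨b, hb⟩ := h.even_im
  obtain ⟨G, hG⟩ : ∃ G, g = 4 * G + 1 := ⟨g / 4, by have := h.g_mod_four; omega⟩
  obtain ⟨u, hu⟩ := (Int.even_mul_succ_self k).two_dvd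
  obtain ⟨v, hv⟩ := (Int.even_mul_succ_self b).two_dvd
  have hN : W.norm - 1 = 4 * (2 * u + 2 * v - b) := by
    rw [norm_eq_sq_add_sq, hk, hb]
    linear_combination 4 * hu + 4 * hv
  have hdiff : x + d - c = 4 * ((4 * G + 1) * b) := by
    rw [h.x_add_d_eq, h.c_eq, hb, hG]
    ring
  rw [hN, hdiff, Int.mul_ediv_cancel_left _ four_ne_zero, Int.mul_ediv_cancel_left _ four_ne_zero]
  push_cast
  have h4 : (4 : ZMod 4) = 0 := rfl
  linear_combination ((u : ZMod 4) + v - b - 2 * G * b) * h4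

theorem map_mul_eq {L : ℤ → ZMod 4} (hL : IsRationalSymbol L W)
    (h : IsDescent p q c d x y g z y₀ s W) :
    L x + L (W.re + W.im) = L (-1) + L q + 2 * s * L 2 + L z := by
  have h2s : IsCoprime (2 ^ (2 * s)) W.norm := h.isCoprime_two_norm.pow_left
  have h2z := h2s.mul_left h.isCoprime_z_norm
  have hcongr : L (x * (W.re + W.im)) = L (-1 * (q * (2 ^ (2 * s) * z))) :=
    hL.congr ⟨g, by linear_combination -h.g_mul_norm⟩
  rw [← hL.map_mul h.isCoprime_x_norm h.isCoprime_re_add_im_norm, hcongr,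
    hL.map_mul isCoprime_one_left.neg_left h.isCoprime_mul_norm,
    hL.map_mul h.isCoprime_q_norm h2z, hL.map_mul h2s h.isCoprime_z_norm,
    hL.map_pow h.isCoprime_two_norm]
  push_cast
  ring

theorem quarticChar_sub_quarticChar (h : IsDescent p q c d x y g z y₀ s W) :
    quarticChar p ⟨c, d⟩ x - quarticChar p ⟨c, d⟩ y₀ = ((x - 1) / 4 : ℤ) + ((x + d - 1) / 4 : ℤ) +
      quarticJacobi q ⟨c, x + d⟩ - ((q - 1) / 4 : ℤ) + (1 + s) * (2 * ((x + d - c) / 4 : ℤ)) := by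
  obtain ⟨L, hL⟩ := exists_isRationalSymbol h.isCoprime_re_im h.odd_re h.even_im
  have hsum := h.map_mul_eq hL
  have htwo := hL.two_mul_map_two
  rw [hL.eq_quarticJacobi h.x_mod_four h.isCoprime_x_norm,
    hL.eq_quarticJacobi h.re_add_im_mod_four h.isCoprime_re_add_im_norm,
    hL.eq_quarticJacobi h.q_mod_four h.isCoprime_q_norm,
    hL.eq_quarticJacobi h.z_mod_four h.isCoprime_z_norm, hL.map_neg_one,
    h.intCast_norm_sub_one_div_four, h.quarticJacobi_z] at hsum
  rw [h.intCast_norm_sub_one_div_four] at htwo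
  rw [h.x_add_d_eq, intCast_mul_sub_one_div_four h.g_mod_four h.re_add_im_mod_four,
    ← h.x_add_d_eq]
  linear_combination -h.quarticJacobi_add_x - h.quarticJacobi_re_add_im + h.quarticJacobi_add_q +
    hsum + s * htwo

end IsDescent

namespace IsDoubleRep

variable {p : ℕ} {q c d x y : ℤ}

theorem two_mul_sub_eq (h : IsDoubleRep p q c d x y) (hx : x % 4 = 1) (hd : 4 ∣ d) :
    (2 * (((x - 1) / 4 : ℤ) - ((c - 1) / 4 : ℤ)) : ZMod 4) = 2 * (y / 2 : ℤ) := by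
  have hp := h.eq_sq_add_sq.symm.trans h.eq_sq_add_mul_sq
  obtain ⟨C, rfl⟩ : ∃ C, c = 4 * C + 1 := ⟨c / 4, by have := h.c_mod_four; omega⟩
  obtain ⟨Q, rfl⟩ : ∃ Q, q = 4 * Q + 1 := ⟨q / 4, by have := h.q_mod_four; omega⟩
  obtain ⟨X, rfl⟩ : ∃ X, x = 4 * X + 1 := ⟨x / 4, by omega⟩
  obtain ⟨D, rfl⟩ := hd
  obtain ⟨Y, rfl⟩ := h.two_dvd_y
  have hXC : 2 * X ^ 2 + X + (4 * Q + 1) * Y ^ 2 = 2 * C ^ 2 + C + 2 * D ^ 2 := by linarith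
  have hXC4 := congrArg (Int.cast (R := ZMod 4)) hXC
  rw [show (4 * X + 1 - 1) / 4 = X by omega, show (4 * C + 1 - 1) / 4 = C by omega,
    show 2 * Y / 2 = Y by omega]
  push_cast at hXC4
  generalize (X : ZMod 4) = X at *
  generalize (Y : ZMod 4) = Y at *
  generalize (Q : ZMod 4) = Q at *
  generalize (C : ZMod 4) = C at *
  generalize (D : ZMod 4) = D at *
  have h4 : (4 : ZMod 4) = 0 := rfl
  rw [h4, zero_mul, zero_add, one_mul] at hXC4
  clear h hp hXC Q
  decide +revert

variable [Fact p.Prime]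

theorem four_dvd_d (h : IsDoubleRep p q c d x y) : 4 ∣ d :=
  h.isSplitPrime.four_dvd_im h.p_mod_eight

theorem pow_mul_pow_mul_pow (h : IsDoubleRep p q c d x y) :
    imagResidue p ⟨c, d⟩ ^ (quarticChar p ⟨c, d⟩ x).val =
      (-q : ZMod p) ^ ((p - 1) / 8) * 2 ^ ((p - 1) / 8) *
        imagResidue p ⟨c, d⟩ ^ (quarticChar p ⟨c, d⟩ y).val := by
  have hp := congrArg (Int.cast (R := ZMod p)) h.eq_sq_add_mul_sq
  push_cast at hp
  rw [CharP.cast_eq_zero] at hp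
  rw [← h.isSplitPrime.sq_pow_eq h.p_mod_eight
    (intCast_ne_zero_of_isCoprime p h.isCoprime_x_p dvd_rfl),
    ← h.isSplitPrime.sq_pow_eq h.p_mod_eight
    (intCast_ne_zero_of_isCoprime p h.isCoprime_y_p dvd_rfl), ← mul_pow, ← mul_pow]
  congr 1
  linear_combination -hp

end IsDoubleRep

namespace IsDescent

variable {p : ℕ} {q c d x y g z y₀ : ℤ} {s : ℕ} {W : GaussianInt}

theorem two_mul_intCast_mul_one_sub (h : IsDescent p q c d x y g z y₀ s W) :
    (2 * (y / 2 : ℤ) * (1 - s) : ZMod 4) = 0 := by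
  have hy : 2 ^ 1 * (y / 2) = 2 ^ s * y₀ := by
    rw [← h.y_eq, pow_one, Int.mul_ediv_cancel' h.two_dvd_y]
  rcases even_or_eq_of_two_pow_mul_eq hy h.y₀_odd with heven | rfl
  · rw [two_mul_intCast_eq_zero heven, zero_mul]
  · rw [Nat.cast_one, sub_self, mul_zero]

variable [Fact p.Prime]

theorem quarticChar_y (h : IsDescent p q c d x y g z y₀ s W) :
    quarticChar p ⟨c, d⟩ y = s * (2 * (d / 4 : ℤ)) + quarticChar p ⟨c, d⟩ y₀ := by
  have hπ := h.isSplitPrime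
  have hne := intCast_ne_zero_of_isCoprime (R := ZMod p) p h.isCoprime_y_p dvd_rfl
  have h2 : IsCoprime 2 (⟨c, d⟩ : GaussianInt).norm := by
    have h8 := h.p_mod_eight
    rw [hπ.norm_eq]
    exact (isCoprime_two (by omega)).symm
  rw [h.y_eq, Int.cast_mul] at hne ⊢
  rw [hπ.quarticChar_mul (left_ne_zero_of_mul hne) (right_ne_zero_of_mul hne),
    hπ.isRationalSymbol.map_pow h2, Int.cast_ofNat, hπ.quarticChar_two h.p_mod_eight h.c_mod_four]

end IsDescent

namespace IsDoubleRep

variable {p : ℕ} [Fact p.Prime] {q c d x y : ℤ}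

theorem neg_pow_eq (h : IsDoubleRep p q c d x y) (hx : x % 4 = 1) (hq : IsCoprime q (x + d)) :
    (-q : ZMod p) ^ ((p - 1) / 8) = imagResidue p ⟨c, d⟩ ^ (quarticJacobi q ⟨c, x + d⟩ -
      ((q - 1) / 4 : ℤ) + 2 * (d / 4 : ℤ) + 2 * (y / 2 : ℤ) : ZMod 4).val := by
  have hπ := h.isSplitPrime
  have hζ := hπ.isPrimitiveRoot_imagResidue.pow_eq_one
  have hζ0 := hπ.isPrimitiveRoot_imagResidue.ne_zero four_ne_zero
  obtain ⟨g, z, y₀, s, W, hW⟩ := h.exists_isDescent hx hq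
  have hkey := hW.quarticChar_sub_quarticChar
  have hXC := h.two_mul_sub_eq hx h.four_dvd_d
  have hsY := hW.two_mul_intCast_mul_one_sub
  have hpow := h.pow_mul_pow_mul_pow
  rw [hπ.two_pow_eq h.p_mod_eight h.c_mod_four, mul_assoc, ← pow_val_add hζ] at hpow
  refine mul_right_cancel₀ (pow_ne_zero _ hζ0) (hpow.symm.trans ?_)
  rw [← pow_val_add hζ]
  congr 2
  obtain ⟨C, hC⟩ : ∃ C, c = 4 * C + 1 := ⟨c / 4, by have := h.c_mod_four; omega⟩
  obtain ⟨X, hX⟩ : ∃ X, x = 4 * X + 1 := ⟨x / 4, by omega⟩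
  obtain ⟨D, hD⟩ := h.four_dvd_d
  have h4 : (4 : ZMod 4) = 0 := rfl
  rw [show (x + d - 1) / 4 = X + D by omega, show (x + d - c) / 4 = X + D - C by omega,
    show (x - 1) / 4 = X by omega] at hkey
  rw [show (x - 1) / 4 = X by omega, show (c - 1) / 4 = C by omega] at hXC
  rw [hW.quarticChar_y, show d / 4 = D by omega, show (c - 1) / 4 = C by omega]
  push_cast at hkey ⊢
  linear_combination hkey + (s : ZMod 4) * hXC - hsY + ((X : ZMod 4) - C) * h4

end IsDoubleRep

/-! ### Primes of the form `x² + 10y²` -/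

theorem isSquare_five_of_mod_five {p : ℕ} [Fact p.Prime] (h2 : p % 2 = 1)
    (h5 : p % 5 = 1 ∨ p % 5 = 4) : IsSquare (5 : ZMod p) := by
  have hp : IsSquare ((p : ℕ) : ZMod 5) := by
    rw [← ZMod.natCast_mod]
    rcases h5 with h | h <;> rw [h] <;> decide
  exact_mod_cast (ZMod.exists_sq_eq_prime_iff_of_mod_four_eq_one (p := 5) (q := p) rfl
    (by omega)).mp hp

theorem exists_sq_eq_neg_ten {p : ℕ} [Fact p.Prime] (h8 : p % 8 = 1)
    (h5 : p % 5 = 1 ∨ p % 5 = 4) : ∃ z : ZMod p, z ^ 2 = -10 := by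
  have hneg : IsSquare (-1 : ZMod p) := ZMod.exists_sq_eq_neg_one_iff.mpr (by omega)
  have htwo : IsSquare (2 : ZMod p) :=
    (ZMod.exists_sq_eq_two_iff (by omega)).mpr (Or.inl h8)
  obtain ⟨z, hz⟩ := (hneg.mul htwo).mul (isSquare_five_of_mod_five (by omega) h5)
  exact ⟨z, by linear_combination -hz⟩

theorem exists_sq_lt_and_eq_mul {p : ℕ} [hp : Fact p.Prime] (z : ZMod p) :
    ∃ x y : ℤ, (x ≠ 0 ∨ y ≠ 0) ∧ (x : ZMod p) = z * y ∧ x ^ 2 < p ∧ y ^ 2 < p := by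
  have hcard : Fintype.card (ZMod p) <
      Fintype.card (Fin (p.sqrt + 1) × Fin (p.sqrt + 1)) := by
    rw [ZMod.card, Fintype.card_prod, Fintype.card_fin]
    exact Nat.lt_succ_sqrt p
  obtain ⟨u, v, huv, hF⟩ := Fintype.exists_ne_map_eq_of_card_lt
    (fun u : Fin (p.sqrt + 1) × Fin (p.sqrt + 1) => ((u.1 : ℕ) - z * (u.2 : ℕ) : ZMod p)) hcard
  have hsqrt : (p.sqrt : ℤ) ^ 2 < p := by
    refine lt_of_le_of_ne (by exact_mod_cast Nat.sqrt_le' p) fun h => ?_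
    exact Nat.Prime.not_prime_pow le_rfl ((by exact_mod_cast h : p.sqrt ^ 2 = p) ▸ hp.out)
  have hbound (m n : Fin (p.sqrt + 1)) : (((m : ℕ) : ℤ) - (n : ℕ)) ^ 2 < p :=
    (sq_le_sq' (by omega) (by omega)).trans_lt hsqrt
  refine ⟨(u.1 : ℕ) - (v.1 : ℕ), (u.2 : ℕ) - (v.2 : ℕ), ?_, ?_, hbound _ _, hbound _ _⟩
  · by_contra! h
    exact huv (Prod.ext (Fin.ext (by omega)) (Fin.ext (by omega)))
  · push_cast
    linear_combination hF

theorem two_mul_sq_add_five_mul_sq_mod_eight (a b : ℤ) :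
    (2 * a ^ 2 + 5 * b ^ 2) % 8 ≠ 1 ∧ (2 * a ^ 2 + 5 * b ^ 2) % 8 ≠ 3 := by
  have hmod : ∀ u v : ZMod 8, 2 * u ^ 2 + 5 * v ^ 2 ≠ 1 ∧ 2 * u ^ 2 + 5 * v ^ 2 ≠ 3 := by decide
  have hcast (r : ℤ) (h : (2 * a ^ 2 + 5 * b ^ 2) % 8 = r) :
      (2 * (a : ZMod 8) ^ 2 + 5 * (b : ZMod 8) ^ 2) = r := by
    rw [← h, show (8 : ℤ) = (8 : ℕ) from rfl, ZMod.intCast_mod]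
    push_cast
    rfl
  exact ⟨fun h => (hmod a b).1 (by simpa using hcast 1 h),
    fun h => (hmod a b).2 (by simpa using hcast 3 h)⟩

theorem dvd_of_dvd_sq_add_ten_mul_sq {n x y : ℤ} (hn : Prime n) (h10 : n ∣ 10)
    (h : n ∣ x ^ 2 + 10 * y ^ 2) : n ∣ x :=
  hn.dvd_of_dvd_pow ((dvd_add_left (h10.mul_right _)).mp h)

theorem three_dvd_of_three_dvd_sq_add_ten_mul_sq {x y : ℤ} (h : 3 ∣ x ^ 2 + 10 * y ^ 2) :
    3 ∣ x ∧ 3 ∣ y := by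
  have hmod : ∀ u v : ZMod 3, u ^ 2 + 10 * v ^ 2 = 0 → u = 0 ∧ v = 0 := by decide
  have hcast (n : ℤ) : (n : ZMod 3) = 0 ↔ 3 ∣ n := ZMod.intCast_zmod_eq_zero_iff_dvd n 3
  rw [← hcast, ← hcast]
  exact hmod x y (by exact_mod_cast (hcast _).mpr h)

theorem sq_mod_five (x : ℤ) : x ^ 2 % 5 = 0 ∨ x ^ 2 % 5 = 1 ∨ x ^ 2 % 5 = 4 := by
  rw [sq, Int.mul_emod]
  rcases (by omega : x % 5 = 0 ∨ x % 5 = 1 ∨ x % 5 = 2 ∨ x % 5 = 3 ∨ x % 5 = 4) with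
    h | h | h | h | h <;> rw [h] <;> decide

theorem exists_eq_sq_add_ten_mul_sq_of_mul {n K x y : ℤ} (h8 : n % 8 = 1)
    (h5 : n % 5 = 1 ∨ n % 5 = 4) (hK0 : 0 < K) (hK : K < 11) (h : K * n = x ^ 2 + 10 * y ^ 2) :
    ∃ a b : ℤ, n = a ^ 2 + 10 * b ^ 2 := by
  have hx5 := sq_mod_five x
  have two_dvd_x (k : ℤ) (hk : 2 * k = x ^ 2 + 10 * y ^ 2) : 2 ∣ x :=
    dvd_of_dvd_sq_add_ten_mul_sq Int.prime_two (by decide) (Dvd.intro k hk)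
  have five_dvd_x (k : ℤ) (hk : 5 * k = x ^ 2 + 10 * y ^ 2) : 5 ∣ x :=
    dvd_of_dvd_sq_add_ten_mul_sq (Nat.prime_iff_prime_int.mp Nat.prime_five) (by decide)
      (Dvd.intro k hk)
  obtain rfl | rfl | rfl | rfl | rfl | rfl :
      K = 1 ∨ K = 4 ∨ K = 5 ∨ K = 6 ∨ K = 9 ∨ K = 10 := by
    interval_cases K <;> omega
  · exact ⟨x, y, by linarith⟩
  · obtain ⟨a, rfl⟩ := two_dvd_x (2 * n) (by linarith)
    have hy : Even (y ^ 2) := Int.even_iff.mpr (by ring_nf at h; omega)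
    obtain ⟨b, rfl⟩ := (Int.even_pow.mp hy).1.two_dvd
    exact ⟨a, b, by linarith⟩
  · obtain ⟨a, rfl⟩ := five_dvd_x n h
    exact absurd (by rw [← h8]; congr 1; linarith) (two_mul_sq_add_five_mul_sq_mod_eight y a).1
  · obtain ⟨a, rfl⟩ := two_dvd_x (3 * n) (by linarith)
    have h3 : 2 * a ^ 2 + 5 * y ^ 2 = 3 * n := by linarith
    exact absurd (by omega) (two_mul_sq_add_five_mul_sq_mod_eight a y).2
  · obtain ⟨⟨a, rfl⟩, b, rfl⟩ := three_dvd_of_three_dvd_sq_add_ten_mul_sq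
      (Dvd.intro (3 * n) (by linarith : 3 * (3 * n) = x ^ 2 + 10 * y ^ 2))
    exact ⟨a, b, by linarith⟩
  · have h2 := two_dvd_x (5 * n) (by linarith)
    have h5' := five_dvd_x (2 * n) (by linarith)
    obtain ⟨a, rfl⟩ : 10 ∣ x := by omega
    exact ⟨y, a, by linarith⟩

theorem exists_eq_sq_add_ten_mul_sq {p : ℕ} [hp : Fact p.Prime] (h8 : p % 8 = 1)
    (h5 : p % 5 = 1 ∨ p % 5 = 4) : ∃ x y : ℤ, (p : ℤ) = x ^ 2 + 10 * y ^ 2 := by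
  obtain ⟨z, hz⟩ := exists_sq_eq_neg_ten h8 h5
  obtain ⟨x, y, hne, hxy, hx, hy⟩ := exists_sq_lt_and_eq_mul z
  obtain ⟨K, hK⟩ : (p : ℤ) ∣ x ^ 2 + 10 * y ^ 2 := by
    rw [← ZMod.intCast_zmod_eq_zero_iff_dvd]
    push_cast
    rw [hxy]
    linear_combination (y : ZMod p) ^ 2 * hz
  have hp0 : (0 : ℤ) < p := by exact_mod_cast hp.out.pos
  have hpos : 0 < x ^ 2 + 10 * y ^ 2 := by
    rcases hne with h | h <;> positivity
  exact exists_eq_sq_add_ten_mul_sq_of_mul (by omega) (by omega)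
    (pos_of_mul_pos_right (hK ▸ hpos) hp0.le) (by nlinarith) ((mul_comm _ _).trans hK.symm)

/-! ### The octic residue symbol of `-5` -/

theorem neg_one_zpow_congr {K : Type*} [DivisionRing K] {m n : ℤ} (h : 2 ∣ m - n) :
    (-1 : K) ^ m = (-1) ^ n := by
  rw [← sub_add_cancel m n, zpow_add₀ (neg_ne_zero.mpr one_ne_zero),
    Even.neg_one_zpow (even_iff_two_dvd.mpr h), one_mul]

theorem neg_one_zpow_eq_neg {K : Type*} [DivisionRing K] {m n : ℤ} (h : 2 ∣ m - n - 1) :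
    (-1 : K) ^ m = -(-1) ^ n := by
  rw [neg_one_zpow_congr (n := n + 1) (by rwa [← sub_sub]),
    zpow_add_one₀ (neg_ne_zero.mpr one_ne_zero), mul_neg_one]

theorem isCoprime_five {m : ℤ} (h : ¬5 ∣ m) : IsCoprime 5 m :=
  (Nat.prime_iff_prime_int.mp Nat.prime_five).coprime_iff_not_dvd.mpr h

theorem quarticJacobi_five_one_add_I : quarticJacobi 5 ⟨1, 1⟩ = 1 := by
  rw [quarticJacobi_one_add_I rfl]
  rfl

theorem quarticJacobi_five_I : quarticJacobi 5 ⟨0, 1⟩ = 2 := by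
  rw [quarticJacobi_I rfl, quarticJacobi_five_one_add_I]
  rfl

theorem quarticJacobi_five_I_sub_one : quarticJacobi 5 ⟨-1, 1⟩ = 3 := by
  rw [show (⟨-1, 1⟩ : GaussianInt) = ⟨0, 1⟩ * ⟨1, 1⟩ by decide,
    quarticJacobi_mul rfl (isCoprime_norm_I 5) (isCoprime_norm_one_add_I rfl),
    quarticJacobi_five_I, quarticJacobi_five_one_add_I]
  rfl

theorem quarticJacobi_five_eq {a b x : ℤ} {α : GaussianInt} (hx : ¬5 ∣ x)
    (hα : IsCoprime 5 α.norm) (ha : 5 ∣ a - x * α.re) (hb : 5 ∣ b - x * α.im) :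
    quarticJacobi 5 ⟨a, b⟩ = quarticJacobi 5 α := by
  rw [← quarticJacobi_intCast_mul rfl (isCoprime_five hx) hα]
  refine quarticJacobi_congr ((Zsqrtd.intCast_dvd _ _).mpr ⟨?_, ?_⟩)
  · simpa using ha
  · simpa using hb

namespace IsDoubleRep

variable {p : ℕ} {c d x y : ℤ}

theorem not_five_dvd_x (h : IsDoubleRep p 5 c d x y) : ¬5 ∣ x := by
  intro hx
  have h1 := h.isCoprime_x_q.isUnit_of_dvd' hx dvd_rfl
  exact absurd (Int.isUnit_iff.mp h1) (by decide)

theorem sq_add_sq_zmod_five (h : IsDoubleRep p 5 c d x y) :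
    (c : ZMod 5) ^ 2 + (d : ZMod 5) ^ 2 = (x : ZMod 5) ^ 2 := by
  have hp := congrArg (Int.cast (R := ZMod 5)) (h.eq_sq_add_sq.symm.trans h.eq_sq_add_mul_sq)
  push_cast at hp
  rw [hp, show (10 : ZMod 5) = 0 from rfl, zero_mul, add_zero]

theorem dvd_of_two_mul_sub_div_eq (h : IsDoubleRep p 5 c d x y) :
    ((2 * c - d : ZMod 5) / (x : ZMod 5) = 2 → 5 ∣ d ∧ 5 ∣ x - c) ∧
    ((2 * c - d : ZMod 5) / (x : ZMod 5) = -2 → 5 ∣ d ∧ 5 ∣ x + c) ∧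
    ((2 * c - d : ZMod 5) / (x : ZMod 5) = 1 → 5 ∣ c ∧ 5 ∣ x + d) ∧
    ((2 * c - d : ZMod 5) / (x : ZMod 5) = -1 → 5 ∣ c ∧ 5 ∣ x - d) := by
  have hdvd (n : ℤ) : 5 ∣ n ↔ (n : ZMod 5) = 0 := (ZMod.intCast_zmod_eq_zero_iff_dvd n 5).symm
  have hx := h.not_five_dvd_x
  have hsq := h.sq_add_sq_zmod_five
  rw [hdvd] at hx
  simp only [hdvd, div_eq_iff hx, Int.cast_sub, Int.cast_add]
  generalize (c : ZMod 5) = c, (d : ZMod 5) = d, (x : ZMod 5) = x at hx hsq ⊢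
  clear h
  decide +revert

variable [Fact p.Prime]

theorem neg_five_pow_eq (h : IsDoubleRep p 5 c d x y) (hx : x % 4 = 1) (hxd : ¬5 ∣ x + d) :
    (-5 : ZMod p) ^ ((p - 1) / 8) =
      imagResidue p ⟨c, d⟩ ^ (quarticJacobi 5 ⟨c, x + d⟩ - 1).val * (-1) ^ (d / 4 + y / 2) := by
  have hI := h.isSplitPrime.isPrimitiveRoot_imagResidue
  have hexp : quarticJacobi 5 ⟨c, x + d⟩ - ((5 - 1) / 4 : ℤ) + 2 * (d / 4 : ℤ) + 2 * (y / 2 : ℤ) =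
      quarticJacobi 5 ⟨c, x + d⟩ - 1 + ((2 * (d / 4 + y / 2) : ℤ) : ZMod 4) := by
    push_cast [show ((5 : ℤ) - 1) / 4 = 1 from rfl]
    ring
  have hpow := h.neg_pow_eq hx (isCoprime_five hxd)
  rwa [Int.cast_ofNat, hexp, pow_val_add hI.pow_eq_one,
    pow_val_intCast (hI.ne_zero four_ne_zero) hI.pow_eq_one, zpow_mul, zpow_ofNat,
    h.isSplitPrime.imagResidue_sq] at hpow

theorem neg_five_pow_of_dvd_d_of_dvd_x_sub_c (h : IsDoubleRep p 5 c d x y) (hd : 5 ∣ d)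
    (hxc : 5 ∣ x - c) :
    (-5 : ZMod p) ^ ((p - 1) / 8) = (-1) ^ (d / 4 + (x - 1) / 2 + y / 2) := by
  have hx5 := h.not_five_dvd_x
  have hodd := h.x_odd
  rcases (by omega : x % 4 = 1 ∨ -x % 4 = 1) with hx | hx
  · rw [h.neg_five_pow_eq hx (by omega), quarticJacobi_five_eq (α := ⟨1, 1⟩) hx5
      (isCoprime_norm_one_add_I rfl) (by dsimp only; omega) (by dsimp only; omega),
      quarticJacobi_five_one_add_I, sub_self, ZMod.val_zero, pow_zero, one_mul]
    exact neg_one_zpow_congr (by omega)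
  · rw [h.neg_x.neg_five_pow_eq hx (by omega), quarticJacobi_five_eq (x := -x) (α := ⟨-1, 1⟩)
      (by omega) (by decide) (by dsimp only; omega) (by dsimp only; omega),
      quarticJacobi_five_I_sub_one, show (3 - 1 : ZMod 4).val = 2 from rfl,
      h.isSplitPrime.imagResidue_sq, neg_one_mul]
    exact (neg_one_zpow_eq_neg (by omega)).symm

theorem neg_five_pow_of_dvd_d_of_dvd_x_add_c (h : IsDoubleRep p 5 c d x y) (hd : 5 ∣ d)
    (hxc : 5 ∣ x + c) :
    (-5 : ZMod p) ^ ((p - 1) / 8) = -(-1) ^ (d / 4 + (x - 1) / 2 + y / 2) := by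
  have hodd := h.x_odd
  rw [h.neg_x.neg_five_pow_of_dvd_d_of_dvd_x_sub_c hd (by omega)]
  exact neg_one_zpow_eq_neg (by omega)

theorem neg_five_pow_of_dvd_c_of_x_mod_four (h : IsDoubleRep p 5 c d x y) (hc : 5 ∣ c)
    (hxd : 5 ∣ x - d) (hx : x % 4 = 1) :
    (-5 : ZMod p) ^ ((p - 1) / 8) =
      -((-1) ^ (d / 4 + y / 2) * ((c : ZMod p) / (d : ZMod p))) := by
  have hx5 := h.not_five_dvd_x
  rw [h.neg_five_pow_eq hx (by omega), quarticJacobi_five_eq (x := 2 * x) (α := ⟨0, 1⟩)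
    (by omega) (isCoprime_norm_I 5) (by dsimp only; omega) (by dsimp only; omega),
    quarticJacobi_five_I, show (2 - 1 : ZMod 4).val = 1 from rfl, pow_one, imagResidue]
  ring

theorem neg_five_pow_of_dvd_c_of_dvd_x_sub_d (h : IsDoubleRep p 5 c d x y) (hc : 5 ∣ c)
    (hxd : 5 ∣ x - d) :
    (-5 : ZMod p) ^ ((p - 1) / 8) =
      -((-1) ^ (d / 4 + (x - 1) / 2 + y / 2) * ((c : ZMod p) / (d : ZMod p))) := by
  have hodd := h.x_odd
  have hd := h.four_dvd_d
  rcases (by omega : x % 4 = 1 ∨ -x % 4 = 1) with hx | hx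
  · rw [h.neg_five_pow_of_dvd_c_of_x_mod_four hc hxd hx,
      neg_one_zpow_congr (m := d / 4 + (x - 1) / 2 + y / 2) (n := d / 4 + y / 2) (by omega)]
  · rw [h.neg_x.neg_d.neg_five_pow_of_dvd_c_of_x_mod_four hc (by omega) hx,
      neg_one_zpow_eq_neg (m := d / 4 + (x - 1) / 2 + y / 2) (n := -d / 4 + y / 2) (by omega),
      Int.cast_neg, div_neg, mul_neg, neg_mul]

theorem neg_five_pow_of_dvd_c_of_dvd_x_add_d (h : IsDoubleRep p 5 c d x y) (hc : 5 ∣ c)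
    (hxd : 5 ∣ x + d) :
    (-5 : ZMod p) ^ ((p - 1) / 8) =
      (-1) ^ (d / 4 + (x - 1) / 2 + y / 2) * ((c : ZMod p) / (d : ZMod p)) := by
  have hd := h.four_dvd_d
  rw [h.neg_d.neg_five_pow_of_dvd_c_of_dvd_x_sub_d hc (by omega),
    neg_one_zpow_congr (n := d / 4 + (x - 1) / 2 + y / 2) (by omega), Int.cast_neg, div_neg,
    mul_neg, neg_neg]

end IsDoubleRep

theorem isDoubleRep_five {p : ℕ} {c d x y : ℤ} (h8 : p % 8 = 1) (h5 : p % 5 = 1 ∨ p % 5 = 4)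
    (hcd : (p : ℤ) = c ^ 2 + d ^ 2) (hxy : (p : ℤ) = x ^ 2 + 10 * y ^ 2) (hc : c ≡ 1 [ZMOD 4]) :
    IsDoubleRep p 5 c d x y where
  eq_sq_add_sq := hcd
  eq_sq_add_mul_sq := hxy
  p_mod_eight := h8
  c_mod_four := hc
  q_mod_four := rfl
  isCoprime_x_q := by
    refine (isCoprime_five ?_).symm
    rintro ⟨m, rfl⟩
    have hsq : (5 * m) ^ 2 = 5 * (5 * m ^ 2) := by ring
    omega

theorem corollary4p5_general (p : ℕ) [Fact p.Prime] (hp : p ≡ 1 [MOD 40] ∨ p ≡ 9 [MOD 40]) :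
    (∃ c d x y : ℤ, (p : ℤ) = c ^ 2 + d ^ 2 ∧ (p : ℤ) = x ^ 2 + 10 * y ^ 2) ∧
    ∀ c d x y : ℤ,
      (p : ℤ) = c ^ 2 + d ^ 2 → (p : ℤ) = x ^ 2 + 10 * y ^ 2 → c ≡ 1 [ZMOD 4] →
      (4 ∣ d ∧ 2 ∣ x - 1 ∧ 2 ∣ y ∧ ¬ (p : ℤ) ∣ d ∧ ¬ (5 : ℤ) ∣ x) ∧
      ((2 * c - d : ZMod 5) / (x : ZMod 5) = 2 →
        (-5 : ZMod p) ^ ((p - 1) / 8) = (-1) ^ (d / 4 + (x - 1) / 2 + y / 2)) ∧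
      ((2 * c - d : ZMod 5) / (x : ZMod 5) = -2 →
        (-5 : ZMod p) ^ ((p - 1) / 8) = -(-1) ^ (d / 4 + (x - 1) / 2 + y / 2)) ∧
      ((2 * c - d : ZMod 5) / (x : ZMod 5) = 1 →
        (-5 : ZMod p) ^ ((p - 1) / 8) =
          (-1) ^ (d / 4 + (x - 1) / 2 + y / 2) * ((c : ZMod p) / (d : ZMod p))) ∧
      ((2 * c - d : ZMod 5) / (x : ZMod 5) = -1 →
        (-5 : ZMod p) ^ ((p - 1) / 8) =
          -((-1) ^ (d / 4 + (x - 1) / 2 + y / 2) * ((c : ZMod p) / (d : ZMod p)))) := by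
  have h8 : p % 8 = 1 := by grind [Nat.ModEq]
  have h5 : p % 5 = 1 ∨ p % 5 = 4 := by grind [Nat.ModEq]
  refine ⟨?_, fun c d x y hcd hxy hc => ?_⟩
  · obtain ⟨x, y, hxy⟩ := exists_eq_sq_add_ten_mul_sq h8 h5
    obtain ⟨c, d, hcd⟩ := Nat.Prime.sq_add_sq (p := p) (by omega)
    exact ⟨c, d, x, y, by exact_mod_cast hcd.symm, hxy⟩
  have h := isDoubleRep_five h8 h5 hcd hxy hc
  obtain ⟨h2, hneg2, h1, hneg1⟩ := h.dvd_of_two_mul_sub_div_eq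
  refine ⟨⟨h.four_dvd_d, Int.modEq_iff_dvd.mp h.x_odd.symm, h.two_dvd_y, ?_, h.not_five_dvd_x⟩,
    fun hk => h.neg_five_pow_of_dvd_d_of_dvd_x_sub_c (h2 hk).1 (h2 hk).2,
    fun hk => h.neg_five_pow_of_dvd_d_of_dvd_x_add_c (hneg2 hk).1 (hneg2 hk).2,
    fun hk => h.neg_five_pow_of_dvd_c_of_dvd_x_add_d (h1 hk).1 (h1 hk).2,
    fun hk => h.neg_five_pow_of_dvd_c_of_dvd_x_sub_d (hneg1 hk).1 (hneg1 hk).2⟩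
  rw [← ZMod.intCast_zmod_eq_zero_iff_dvd]
  exact h.isSplitPrime.im_ne_zero

theorem corollary4p5 (p : ℕ) [Fact p.Prime] (hp : p ≡ 1 [MOD 40] ∨ p ≡ 9 [MOD 40]) :
    (∃ c d x y : ℤ, (p : ℤ) = c ^ 2 + d ^ 2 ∧ (p : ℤ) = x ^ 2 + 10 * y ^ 2) ∧
    ∀ (c d x y d₀ : ℤ) (r : ℕ),
      (p : ℤ) = c ^ 2 + d ^ 2 → (p : ℤ) = x ^ 2 + 10 * y ^ 2 →
      c ≡ 1 [ZMOD 4] → d = 2 ^ r * d₀ → d₀ ≡ 1 [ZMOD 4] →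
      (Int.gcd c (x + d) = 1 ∨ Int.gcd d₀ (x + c) = 1) →
      -- all divisions in the exponent of `-1` below are exact, and both quotients are genuine
      (4 ∣ d ∧ 2 ∣ x - 1 ∧ 2 ∣ y ∧ ¬ (p : ℤ) ∣ d ∧ ¬ (5 : ℤ) ∣ x) ∧
      ((2 * c - d : ZMod 5) / (x : ZMod 5) = 2 →
        (-5 : ZMod p) ^ ((p - 1) / 8) = (-1) ^ (d / 4 + (x - 1) / 2 + y / 2)) ∧
      ((2 * c - d : ZMod 5) / (x : ZMod 5) = -2 →
        (-5 : ZMod p) ^ ((p - 1) / 8) = -(-1) ^ (d / 4 + (x - 1) / 2 + y / 2)) ∧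
      ((2 * c - d : ZMod 5) / (x : ZMod 5) = 1 →
        (-5 : ZMod p) ^ ((p - 1) / 8) =
          (-1) ^ (d / 4 + (x - 1) / 2 + y / 2) * ((c : ZMod p) / (d : ZMod p))) ∧
      ((2 * c - d : ZMod 5) / (x : ZMod 5) = -1 →
        (-5 : ZMod p) ^ ((p - 1) / 8) =
          -((-1) ^ (d / 4 + (x - 1) / 2 + y / 2) * ((c : ZMod p) / (d : ZMod p)))) :=
  have h := corollary4p5_general p hp
  ⟨h.1, fun c d x y _ _ hcd hxy hc _ _ _ => h.2 c d x y hcd hxy hc⟩
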